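/- Let $S=K[x_1,\dots,x_n]$ be a standard graded polynomial ring over a field $K$, let $r\ge 0$, and let $I\subseteq S$ be an ideal generated by homogeneous polynomials of degree $r$. Let $\beta(J)$ denote the Betti diagram of a homogeneous ideal $J$: its entry $\beta_{i,j}(J)$ in column $i$ and degree $j$ (displayed in row $j-i$) is the number of summands $S(-j)$ in step $i$ of the minimal graded free resolution of $J$. For a strictly increasing sequence of integers $\mathbf d=(d_0,\dots,d_s)$ let $\pi(\mathbf d)$ be the diagram whose entry in column $i\le s$ and degree $d_i$ is $\prod_{p\ne i}\frac1{|d_p-d_i|}$ and whose other entries are $0$ (a pure diagram). Order the pure diagrams by $\pi(d_0,\dots,d_s)\le\pi(d'_0,\dots,d'_t)$ if $s\ge t$ and $d_i\le d'_i$ for $0\le i\le t$. Let $B_{M,M'}$ be the $\mathbb Q$-vector space of rational diagrams whose nonzero entries lie in columns $0,\dots,n$ and rows $M,\dots,M'$; a maximal chain in $B_{M,M'}$ is a maximal totally ordered set of pure diagrams belonging to $B_{M,M'}$. A translated family of maximal chains in $B_{rk,rk+N}$ consists of families of pure diagrams $\pi(\mathbf d^0(k)),\dots,\pi(\mathbf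 d^l(k))$ indexed by $k$, each of the form $\mathbf d^i(k)=\mathbf s^i+(a_ik+b_i)(1,\dots,1)$ with a fixed sequence $\mathbf s^i$ and integers $a_i,b_i$, such that $\pi(\mathbf d^0(k))<\cdots<\pi(\mathbf d^l(k))$ is a maximal chain in $B_{rk,rk+N}$ for the values of $k$ under consideration. Then there is an integer $N\ge0$ such that $\beta(I^k)\in B_{rk,rk+N}$ for all sufficiently large $k$. Moreover, for every such $N$ there is a $k_1$ such that for every translated family $\pi(\mathbf d^0(k))<\cdots<\pi(\mathbf d^l(k))$ of maximal chains in $B_{rk,rk+N}$ ($k>k_1$) there are polynomials $w_0,\dots,w_l\in\mathbb Q[t]$ such that, for every $k>k_1$, $$\beta(I^k)=w_0(k)\,\pi(\mathbf d^0(k))+\cdots+w_l(k)\,\pi(\mathbf d^l(k)),$$ and this is the only expression of $\beta(I^k)$ as a linear combination, with rational coefficients, of the diagrams of this chain. The polynomials $w_i$ are not required to take nonnegative values. -/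

import Mathlib

namespace BoijSoederberg

open MvPolynomial

/-! Graded minimal free resolutions and graded Betti numbers of ideals of a polynomial ring -/

section Resolution

variable {K : Type*} [Field K] {n : ℕ}

/-- A minimal graded free resolution
`0 ← I ← ⨁ₐ S(-deg 0 a) ← ⨁ₐ S(-deg 1 a) ← ⋯` of an ideal `I` of `S = K[x₁, …, xₙ]`,
with finitely generated free modules `Fᵢ = S ^ rank i`, where the `a`-th basis vector of `Fᵢ`
has degree `deg i a`. -/
structure MinimalGradedFreeResolution (I : Ideal (MvPolynomial (Fin n) K)) where
  /-- the rank of the `i`-th free module -/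
  rank : ℕ → ℕ
  /-- the degrees of the basis vectors of the `i`-th free module -/
  deg : ∀ i, Fin (rank i) → ℕ
  /-- the augmentation `F₀ → I ⊆ S` -/
  aug : (Fin (rank 0) → MvPolynomial (Fin n) K) →ₗ[MvPolynomial (Fin n) K]
    MvPolynomial (Fin n) K
  /-- the differential `Fᵢ₊₁ → Fᵢ` -/
  diff : ∀ i, (Fin (rank (i + 1)) → MvPolynomial (Fin n) K) →ₗ[MvPolynomial (Fin n) K]
    (Fin (rank i) → MvPolynomial (Fin n) K)
  /-- the augmentation preserves degrees -/
  aug_homogeneous : ∀ a, (aug (Pi.single a 1)).IsHomogeneous (deg 0 a)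
  /-- the differentials preserve degrees -/
  diff_homogeneous : ∀ i b a, diff i (Pi.single b 1) a ≠ 0 →
    ∃ e, deg i a + e = deg (i + 1) b ∧ (diff i (Pi.single b 1) a).IsHomogeneous e
  range_aug : LinearMap.range aug = I
  exact_aug : LinearMap.range (diff 0) = LinearMap.ker aug
  exact_diff : ∀ i, LinearMap.range (diff (i + 1)) = LinearMap.ker (diff i)
  /-- minimality: the image of each differential lies in `(x₁, …, xₙ) Fᵢ` -/
  minimal : ∀ i v a, diff i v a ∈ idealOfVars (Fin n) K

/-- The number of summands `S(-j)` in the `i`-th step of a resolution. -/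
noncomputable def MinimalGradedFreeResolution.betti {I : Ideal (MvPolynomial (Fin n) K)}
    (F : MinimalGradedFreeResolution I) (i : ℕ) (j : ℤ) : ℕ :=
  Nat.card {a : Fin (F.rank i) // (F.deg i a : ℤ) = j}

/-! Existence of the minimal graded free resolution of a homogeneous ideal -/

/-- Homogeneous elements of degree `j` of `⨁ₐ S(-δ a)`. -/
def IsHom {m : ℕ} (δ : Fin m → ℕ) (j : ℕ) (v : Fin m → MvPolynomial (Fin n) K) : Prop :=
  ∀ a, v a ≠ 0 → ∃ e, δ a + e = j ∧ (v a).IsHomogeneous e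

/-- The degree `j` component of an element of `⨁ₐ S(-δ a)`. -/
noncomputable def comp {m : ℕ} (δ : Fin m → ℕ) (j : ℕ) (v : Fin m → MvPolynomial (Fin n) K) :
    Fin m → MvPolynomial (Fin n) K :=
  fun a => if δ a ≤ j then homogeneousComponent (j - δ a) (v a) else 0

theorem comp_isHom {m : ℕ} (δ : Fin m → ℕ) (j : ℕ) (v : Fin m → MvPolynomial (Fin n) K) :
    IsHom δ j (comp δ j v) := by
  intro a ha
  by_cases h : δ a ≤ j
  · refine ⟨j - δ a, by omega, ?_⟩
    simp only [comp, h, if_true]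
    exact homogeneousComponent_isHomogeneous _ _
  · simp [comp, h] at ha

theorem exists_eq_sum_comp {m : ℕ} (δ : Fin m → ℕ) (v : Fin m → MvPolynomial (Fin n) K) :
    ∃ B, v = ∑ j ∈ Finset.range B, comp δ j v := by
  refine ⟨∑ a, (δ a + (v a).totalDegree + 1), ?_⟩
  funext a
  have hB : δ a + (v a).totalDegree + 1 ≤ ∑ a, (δ a + (v a).totalDegree + 1) :=
    Finset.single_le_sum (f := fun a => δ a + (v a).totalDegree + 1)
      (fun _ _ => Nat.zero_le _) (Finset.mem_univ a)
  obtain ⟨c, hc⟩ := Nat.exists_eq_add_of_le hB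
  rw [Finset.sum_apply, hc, show δ a + (v a).totalDegree + 1 + c
    = δ a + ((v a).totalDegree + 1 + c) by ring, Finset.sum_range_add]
  rw [Finset.sum_eq_zero (s := Finset.range (δ a)), zero_add, Finset.sum_range_add,
    Finset.sum_eq_zero (s := Finset.range c), add_zero]
  · conv_lhs => rw [← sum_homogeneousComponent (v a)]
    refine Finset.sum_congr rfl fun i _ => ?_
    simp [comp]
  · intro x _
    simp only [comp]
    rw [if_pos (by omega), homogeneousComponent_eq_zero]
    omega
  · intro x hx
    rw [Finset.mem_range] at hx
    simp [comp, show ¬ δ a ≤ x by omega]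

theorem homogeneousComponent_mul {e : ℕ} {g : MvPolynomial (Fin n) K} (hg : g.IsHomogeneous e)
    (s : MvPolynomial (Fin n) K) (j : ℕ) :
    homogeneousComponent j (s * g) =
      if e ≤ j then homogeneousComponent (j - e) s * g else 0 := by
  classical
  let _ := MvPolynomial.gradedAlgebra (σ := Fin n) (R := K)
  have h := DirectSum.coe_decompose_mul_of_right_mem (homogeneousSubmodule (Fin n) K) (a := s) j
    ((mem_homogeneousSubmodule e g).2 hg)
  simpa [← decomposition.decompose'_apply] using h

theorem comp_map {m p : ℕ} (δ : Fin m → ℕ) (δ' : Fin p → ℕ)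
    (φ : (Fin p → MvPolynomial (Fin n) K) →ₗ[MvPolynomial (Fin n) K]
      (Fin m → MvPolynomial (Fin n) K))
    (hφ : ∀ b, IsHom δ (δ' b) (φ (Pi.single b 1))) (j : ℕ)
    (s : Fin p → MvPolynomial (Fin n) K) :
    comp δ j (φ s) = φ (comp δ' j s) := by
  have key : ∀ t : Fin p → MvPolynomial (Fin n) K, ∀ a,
      φ t a = ∑ b, t b * φ (Pi.single b 1) a := by
    intro t a
    conv_lhs => rw [← LinearMap.sum_single_apply (fun _ => MvPolynomial (Fin n) K) t]
    rw [map_sum, Finset.sum_apply]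
    refine Finset.sum_congr rfl fun b _ => ?_
    have : (Pi.single b (t b) : Fin p → MvPolynomial (Fin n) K) = t b • Pi.single b 1 := by
      rw [← Pi.single_smul]; simp
    rw [this, map_smul]; rfl
  funext a
  rw [key]
  have hc : ∀ b, (if δ a ≤ j then homogeneousComponent (j - δ a) (s b * φ (Pi.single b 1) a)
      else 0) = comp δ' j s b * φ (Pi.single b 1) a := by
    intro b
    by_cases h0 : φ (Pi.single b 1) a = 0
    · simp [h0]
    obtain ⟨e, he, hh⟩ := hφ b a h0
    rw [homogeneousComponent_mul hh]
    simp only [comp]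
    by_cases h1 : δ' b ≤ j
    · rw [if_pos (by omega), if_pos (by omega), if_pos h1, show j - δ a - e = j - δ' b by omega]
    · rw [if_neg h1, zero_mul]
      split_ifs <;> first | rfl | omega
  rw [← Finset.sum_congr rfl fun b _ => hc b]
  simp only [comp, key s a]
  split_ifs <;> simp

/-- A homogeneous submodule of a graded free module. -/
structure Stage (K : Type*) [Field K] (n : ℕ) where
  m : ℕ
  δ : Fin m → ℕ
  N : Submodule (MvPolynomial (Fin n) K) (Fin m → MvPolynomial (Fin n) K)
  graded : ∀ v ∈ N, ∀ j, comp δ j v ∈ N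

/-- Homogeneous generators of a stage. -/
def Stage.Gen (T : Stage K n) (p : ℕ) (δ' : Fin p → ℕ)
    (φ : (Fin p → MvPolynomial (Fin n) K) →ₗ[MvPolynomial (Fin n) K]
      (Fin T.m → MvPolynomial (Fin n) K)) : Prop :=
  (∀ b, IsHom T.δ (δ' b) (φ (Pi.single b 1))) ∧ LinearMap.range φ = T.N

theorem Stage.Gen.graded {T : Stage K n} {p : ℕ} {δ' : Fin p → ℕ}
    {φ : (Fin p → MvPolynomial (Fin n) K) →ₗ[MvPolynomial (Fin n) K]
      (Fin T.m → MvPolynomial (Fin n) K)} (h : T.Gen p δ' φ) :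
    ∀ v ∈ LinearMap.ker φ, ∀ j, comp δ' j v ∈ LinearMap.ker φ := by
  intro v hv j
  rw [LinearMap.mem_ker] at hv ⊢
  rw [← comp_map T.δ δ' φ h.1, hv]
  funext a
  simp [comp]

theorem Stage.exists_gen (T : Stage K n) : ∃ p δ' φ, T.Gen p δ' φ := by
  classical
  obtain ⟨G, hG⟩ := (IsNoetherian.noetherian T.N : T.N.FG)
  choose B hB using exists_eq_sum_comp (K := K) (n := n) T.δ
  let idx : Finset ((Fin T.m → MvPolynomial (Fin n) K) × ℕ) :=
    G.sigma (fun g => Finset.range (B g)) |>.image (fun x => (x.1, x.2))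
  let q := idx.equivFin
  let g : Fin idx.card → (Fin T.m → MvPolynomial (Fin n) K) :=
    fun b => comp T.δ (q.symm b).1.2 (q.symm b).1.1
  refine ⟨idx.card, fun b => (q.symm b).1.2, Fintype.linearCombination _ g, ?_, ?_⟩
  · intro b
    rw [Fintype.linearCombination_apply_single, one_smul]
    exact comp_isHom _ _ _
  · rw [Fintype.range_linearCombination]
    apply le_antisymm
    · rw [Submodule.span_le]
      rintro _ ⟨b, rfl⟩
      apply T.graded
      have h := (q.symm b).2
      simp only [idx, Finset.mem_image, Finset.mem_sigma] at h
      obtain ⟨x, ⟨hx, -⟩, hxb⟩ := h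
      rw [← hxb, ← hG]
      exact Submodule.subset_span hx
    · rw [← hG, Submodule.span_le]
      intro v hv
      rw [SetLike.mem_coe, hB v]
      refine Submodule.sum_mem _ fun j hj => Submodule.subset_span ?_
      have : (v, j) ∈ idx := by
        simp only [idx, Finset.mem_image, Finset.mem_sigma]
        exact ⟨⟨v, j⟩, ⟨hv, hj⟩, rfl⟩
      exact ⟨q ⟨(v, j), this⟩, by simp [g]⟩

theorem Stage.exists_minimal_gen (T : Stage K n) : ∃ p δ' φ, T.Gen p δ' φ ∧
    ∀ s ∈ LinearMap.ker φ, ∀ a, s a ∈ idealOfVars (Fin n) K := by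
  classical
  let p := Nat.find T.exists_gen
  obtain ⟨δ', φ, h⟩ := Nat.find_spec T.exists_gen
  refine ⟨_, δ', φ, h, ?_⟩
  have hmin : ∀ q < Nat.find T.exists_gen, ¬ ∃ δ' φ, T.Gen q δ' φ :=
    fun q hq => Nat.find_min T.exists_gen hq
  generalize Nat.find T.exists_gen = p at *
  intro s hs b
  by_contra hb
  have hcc : constantCoeff (s b) ≠ 0 := by
    intro h0
    refine hb ?_
    rw [← pow_one (idealOfVars (Fin n) K), mem_pow_idealOfVars_iff']
    intro x hx
    rw [(Finsupp.degree_eq_zero_iff x).1 (by omega)]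
    exact h0
  obtain _ | q := p
  · exact b.elim0
  apply hmin q (Nat.lt_succ_self q)
  have hs' := h.graded s hs (δ' b)
  set s' := comp δ' (δ' b) s with hs'def
  have hs'b : s' b = C (constantCoeff (s b)) := by
    simp [hs'def, comp, homogeneousComponent_zero, constantCoeff_eq]
  let g : Fin (q + 1) → (Fin T.m → MvPolynomial (Fin n) K) := fun a => φ (Pi.single a 1)
  have hφ : φ = Fintype.linearCombination _ g := by
    apply LinearMap.pi_ext'
    intro a
    ext1
    simp [g, Fintype.linearCombination_apply_single]
  refine ⟨fun a => δ' (b.succAbove a),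
    Fintype.linearCombination _ (fun a => g (b.succAbove a)), ?_, ?_⟩
  · intro a
    rw [Fintype.linearCombination_apply_single, one_smul]
    exact h.1 _
  · rw [← h.2, hφ, Fintype.range_linearCombination, Fintype.range_linearCombination]
    apply le_antisymm
    · apply Submodule.span_mono
      rintro _ ⟨a, rfl⟩
      exact ⟨_, rfl⟩
    · rw [Submodule.span_le]
      have hmem : ∀ a, g (b.succAbove a) ∈
          Submodule.span (MvPolynomial (Fin n) K) (Set.range fun a => g (b.succAbove a)) :=
        fun a => Submodule.subset_span ⟨a, rfl⟩
      rintro _ ⟨a, rfl⟩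
      rcases Fin.eq_self_or_eq_succAbove b a with rfl | ⟨a, rfl⟩
      · have h1 : s' a • g a + ∑ c, s' (a.succAbove c) • g (a.succAbove c) = 0 := by
          rw [← Fin.sum_univ_succAbove (fun c => s' c • g c)]
          rw [LinearMap.mem_ker, hφ, Fintype.linearCombination_apply] at hs'
          exact hs'
        have h2 : s' a • g a ∈ Submodule.span (MvPolynomial (Fin n) K)
            (Set.range fun c => g (a.succAbove c)) := by
          rw [eq_neg_of_add_eq_zero_left h1]
          exact Submodule.neg_mem _ (Submodule.sum_mem _ fun c _ =>
            Submodule.smul_mem _ _ (hmem c))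
        have h3 := Submodule.smul_mem _ (C (constantCoeff (s a))⁻¹) h2
        rw [hs'b, smul_smul, ← C_mul, inv_mul_cancel₀ hcc, C_1, one_smul] at h3
        exact h3
      · exact hmem a

/-- The rank of a minimal system of homogeneous generators. -/
noncomputable def Stage.p (T : Stage K n) : ℕ := T.exists_minimal_gen.choose

/-- The degrees of a minimal system of homogeneous generators. -/
noncomputable def Stage.δ' (T : Stage K n) : Fin T.p → ℕ :=
  T.exists_minimal_gen.choose_spec.choose

/-- The map given by a minimal system of homogeneous generators. -/
noncomputable def Stage.φ (T : Stage K n) :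
    (Fin T.p → MvPolynomial (Fin n) K) →ₗ[MvPolynomial (Fin n) K]
      (Fin T.m → MvPolynomial (Fin n) K) :=
  T.exists_minimal_gen.choose_spec.choose_spec.choose

theorem Stage.gen (T : Stage K n) : T.Gen T.p T.δ' T.φ ∧
    ∀ s ∈ LinearMap.ker T.φ, ∀ a, s a ∈ idealOfVars (Fin n) K :=
  T.exists_minimal_gen.choose_spec.choose_spec.choose_spec

/-- The syzygies of a minimal system of homogeneous generators. -/
noncomputable def Stage.next (T : Stage K n) : Stage K n where
  m := T.p
  δ := T.δ'
  N := LinearMap.ker T.φ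
  graded := T.gen.1.graded

/-- A homogeneous ideal as a homogeneous submodule of `S¹`. -/
noncomputable def Stage.ofIdeal (I : Ideal (MvPolynomial (Fin n) K))
    (hI : ∀ f ∈ I, ∀ j, homogeneousComponent j f ∈ I) : Stage K n where
  m := 1
  δ := 0
  N := Submodule.comap (LinearMap.proj 0) I
  graded := fun v hv j => by
    simpa [comp] using hI _ (show v 0 ∈ I from hv) j

/-- The iterated syzygies. -/
noncomputable def Stage.iter (T : Stage K n) : ℕ → Stage K n
  | 0 => T
  | i + 1 => (T.iter i).next

/-- A homogeneous ideal has a minimal graded free resolution. -/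
theorem exists_minimalGradedFreeResolution (I : Ideal (MvPolynomial (Fin n) K))
    (hI : ∀ f ∈ I, ∀ j, homogeneousComponent j f ∈ I) :
    Nonempty (MinimalGradedFreeResolution I) := by
  let T := Stage.ofIdeal I hI
  let ψ : (Fin T.p → MvPolynomial (Fin n) K) →ₗ[MvPolynomial (Fin n) K]
    (Fin 1 → MvPolynomial (Fin n) K) := T.φ
  have hψ : LinearMap.range ψ = Submodule.comap (LinearMap.proj 0) I := T.gen.1.2
  let ε : (Fin T.p → MvPolynomial (Fin n) K) →ₗ[MvPolynomial (Fin n) K]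
    MvPolynomial (Fin n) K := LinearMap.proj 0 ∘ₗ ψ
  have hr : LinearMap.range ε = I := by
    ext f
    constructor
    · rintro ⟨v, rfl⟩
      have : ψ v ∈ Submodule.comap (LinearMap.proj 0) I := hψ ▸ LinearMap.mem_range_self ψ v
      exact this
    · intro hf
      have : (fun _ => f : Fin 1 → MvPolynomial (Fin n) K) ∈ LinearMap.range ψ := by
        rw [hψ]
        exact hf
      obtain ⟨v, hv⟩ := this
      exact ⟨v, congrFun hv 0⟩
  have hε : LinearMap.ker ε = LinearMap.ker ψ := by
    ext v
    simp only [LinearMap.mem_ker, ε, LinearMap.comp_apply, LinearMap.proj_apply]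
    exact ⟨fun h => funext fun i => by rw [Subsingleton.elim i 0, h, Pi.zero_apply],
      fun h => by rw [h, Pi.zero_apply]⟩
  refine ⟨{
    rank := fun i => (T.iter i).p
    deg := fun i => (T.iter i).δ'
    aug := ε
    diff := fun i => (T.iter (i + 1)).φ
    aug_homogeneous := ?_
    diff_homogeneous := fun i b a h => (T.iter (i + 1)).gen.1.1 b a h
    range_aug := ?_
    exact_aug := ((T.iter 1).gen.1.2).trans hε.symm
    exact_diff := fun i => (T.iter (i + 2)).gen.1.2
    minimal := ?_ }⟩
  · intro a
    by_cases h : ψ (Pi.single a 1) 0 = 0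
    · have h' : ε (Pi.single a 1) = 0 := h
      exact h' ▸ isHomogeneous_zero _ _ _
    · obtain ⟨e, he, hh⟩ := T.gen.1.1 a (0 : Fin 1) h
      have : e = T.δ' a := (zero_add e).symm.trans he
      subst this
      exact hh
  · exact hr
  · intro i v a
    have h1 : (T.iter (i + 1)).φ v ∈ LinearMap.ker (T.iter i).φ := by
      have := LinearMap.mem_range_self (T.iter (i + 1)).φ v
      rwa [(T.iter (i + 1)).gen.1.2] at this
    exact (T.iter i).gen.2 _ h1 a

end Resolution

/-! Betti diagrams, pure diagrams and windows -/

section Diagram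

open scoped Classical in
/-- The graded Betti number `β_{i,j}(I)` of a homogeneous ideal `I` of `K[x₁, …, xₙ]`: the number
of summands `S(-j)` in step `i` of a minimal graded free resolution of `I`. (The value is the
meaningless `0` only if there is no such resolution, which is impossible for homogeneous `I`.) -/
noncomputable def gradedBetti {K : Type*} [Field K] {n : ℕ}
    (I : Ideal (MvPolynomial (Fin n) K)) (i : ℕ) (j : ℤ) : ℕ :=
  if h : Nonempty (MinimalGradedFreeResolution I) then h.some.betti i j else 0

/-- Rational diagrams: the entry of `b` in column `i` and of internal degree `j` is `b i j`. In the
usual display of a Betti table it stands in row `j - i`. -/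
abbrev Diagram : Type := ℕ → ℤ → ℚ

/-- The Betti diagram `β(I)`. -/
noncomputable def bettiDiagram {K : Type*} [Field K] {n : ℕ}
    (I : Ideal (MvPolynomial (Fin n) K)) : Diagram :=
  fun i j => (gradedBetti I i j : ℚ)

/-- The ideal is generated by homogeneous polynomials of degree `r`. -/
def IsEquigenerated {K : Type*} [Field K] {n : ℕ}
    (I : Ideal (MvPolynomial (Fin n) K)) (r : ℕ) : Prop :=
  ∃ G : Set (MvPolynomial (Fin n) K), (∀ g ∈ G, g.IsHomogeneous r) ∧ I = Ideal.span G

/-- The powers of an equigenerated ideal have minimal graded free resolutions. -/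
theorem IsEquigenerated.nonempty_resolution_pow {K : Type*} [Field K] {n r : ℕ}
    {I : Ideal (MvPolynomial (Fin n) K)} (hI : IsEquigenerated I r) (k : ℕ) :
    Nonempty (MinimalGradedFreeResolution (I ^ k)) := by
  let _ := MvPolynomial.gradedAlgebra (σ := Fin n) (R := K)
  obtain ⟨G, hG, rfl⟩ := hI
  have h1 : (Ideal.span G).IsHomogeneous (homogeneousSubmodule (Fin n) K) :=
    Ideal.homogeneous_span _ _ fun g hg => ⟨r, (mem_homogeneousSubmodule r g).2 (hG g hg)⟩
  have h2 : ((Ideal.span G) ^ k).IsHomogeneous (homogeneousSubmodule (Fin n) K) := by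
    induction k with
    | zero => rw [pow_zero, Ideal.one_eq_top]; exact Ideal.IsHomogeneous.top _
    | succ k ih => rw [pow_succ]; exact ih.mul h1
  exact exists_minimalGradedFreeResolution _ fun f hf j => homogeneousComponent_mem_of_mem h2 hf j

/-- A strictly increasing degree sequence `(d₀, …, d_l)`, where `l = len`. -/
@[ext]
structure DegreeSequence where
  /-- the index `l` of the last entry -/
  len : ℕ
  /-- the entries -/
  deg : Fin (len + 1) → ℤ
  strictMono : StrictMono deg

/-- The pure diagram `π(d)`: its entry in column `i` and degree `d_i` is
`∏_{k ≠ i} 1 / |d_k - d_i|`, all other entries are zero. -/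
def pureDiagram (d : DegreeSequence) : Diagram := fun i j =>
  if h : i < d.len + 1 then
    if j = d.deg ⟨i, h⟩ then
      ∏ k ∈ Finset.univ.erase (⟨i, h⟩ : Fin (d.len + 1)),
        (1 : ℚ) / ((|d.deg k - d.deg ⟨i, h⟩| : ℤ) : ℚ)
    else 0
  else 0

/-- `(d₀, …, d_s) ≤ (d'₀, …, d'_t)` if `s ≥ t` and `d_i ≤ d'_i` for `i = 0, …, t`. -/
instance : PartialOrder DegreeSequence where
  le d d' := ∃ h : d'.len ≤ d.len,
    ∀ i : Fin (d'.len + 1), d.deg (Fin.castLE (Nat.succ_le_succ h) i) ≤ d'.deg i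
  le_refl d := ⟨le_rfl, fun _ => le_rfl⟩
  le_trans d d' d'' := by
    rintro ⟨h, hd⟩ ⟨h', hd'⟩
    exact ⟨h'.trans h, fun i => (hd (Fin.castLE (Nat.succ_le_succ h') i)).trans (hd' i)⟩
  le_antisymm := by
    rintro ⟨l, d, hd⟩ ⟨l', d', hd'⟩ ⟨h1, h2⟩ ⟨h3, h4⟩
    obtain rfl : l = l' := le_antisymm h3 h1
    congr 1
    exact funext fun i => le_antisymm (h2 i) (h4 i)

/-- The window `B_{M,N}` for `n` variables: the space of diagrams whose nonzero entries lie in the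
columns `0, …, n` and the rows `M, …, N`. -/
def bettiWindow (n : ℕ) (M N : ℤ) : Submodule ℚ Diagram where
  carrier := {b | ∀ i j, b i j ≠ 0 → i ≤ n ∧ M ≤ j - i ∧ j - i ≤ N}
  zero_mem' := fun _ _ h => absurd rfl h
  add_mem' := by
    intro a b ha hb i j h
    by_cases h0 : a i j = 0
    · exact hb i j fun h1 => h (by simp [h0, h1])
    · exact ha i j h0
  smul_mem' := by
    intro c b hb i j h
    exact hb i j fun h1 => h (by simp [h1])

/-- `d 0 < ⋯ < d l` (that is, `π(d 0) < ⋯ < π(d l)`) is a maximal chain of pure diagrams in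
`B_{M,N}`. -/
def IsMaximalChain (n : ℕ) (M N : ℤ) {l : ℕ} (d : Fin (l + 1) → DegreeSequence) : Prop :=
  StrictMono d ∧ (∀ i, pureDiagram (d i) ∈ bettiWindow n M N) ∧
    ∀ e : DegreeSequence, pureDiagram e ∈ bettiWindow n M N →
      (∀ i, e ≤ d i ∨ d i ≤ e) → ∃ i, e = d i

/-- The degree sequence moved down by `t` rows. -/
def DegreeSequence.translate (d : DegreeSequence) (t : ℤ) : DegreeSequence where
  len := d.len
  deg := fun i => d.deg i + t
  strictMono := fun _ _ h => by simpa using d.strictMono h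

/-- A translated family of pure diagrams: a fixed shape `s` moved down by a linear function
`a * k + b` of `k`. (This is the form for resolutions of ideals.) -/
def IsTranslatedFamily (d : ℕ → DegreeSequence) : Prop :=
  ∃ (s : DegreeSequence) (a b : ℤ), ∀ k : ℕ, d k = s.translate (a * k + b)

/-- For all large `k`, the Betti diagram `β(I^k)` lies in the window `B_{rk, rk+N}`. -/
def IsPowersWindow {K : Type*} [Field K] {n : ℕ}
    (I : Ideal (MvPolynomial (Fin n) K)) (r N : ℕ) : Prop :=
  ∃ k₀ : ℕ, ∀ k : ℕ, k₀ < k → bettiDiagram (I ^ k) ∈ bettiWindow n (r * k) (r * k + N)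

end Diagram

end BoijSoederberg

open BoijSoederberg

namespace BoijSoederberg

open Filter

/-- A sequence of rational numbers which agrees with a polynomial for all large arguments. -/
def EventuallyPolynomial (f : ℕ → ℚ) : Prop :=
  ∃ p : Polynomial ℚ, ∀ᶠ k in atTop, f k = p.eval (k : ℚ)

theorem EventuallyPolynomial.sub {f g : ℕ → ℚ} (hf : EventuallyPolynomial f)
    (hg : EventuallyPolynomial g) : EventuallyPolynomial fun k => f k - g k := by
  obtain ⟨p, hp⟩ := hf
  obtain ⟨q, hq⟩ := hg
  refine ⟨p - q, ?_⟩
  filter_upwards [hp, hq] with k h1 h2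
  simp [h1, h2]

theorem EventuallyPolynomial.shift {f : ℕ → ℚ} (hf : EventuallyPolynomial f) :
    EventuallyPolynomial fun k => f (k + 1) := by
  obtain ⟨p, hp⟩ := hf
  refine ⟨p.comp (Polynomial.X + 1), ?_⟩
  filter_upwards [(tendsto_add_atTop_nat 1).eventually hp] with k h1
  simp [h1]

theorem exists_polynomial_eval_eq_sum_range (p : Polynomial ℚ) :
    ∃ q : Polynomial ℚ, ∀ k : ℕ, q.eval (k : ℚ) = ∑ i ∈ Finset.range k, p.eval (i : ℚ) := by
  induction p using Polynomial.induction_on' with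
  | add p q hp hq =>
    obtain ⟨p', hp⟩ := hp
    obtain ⟨q', hq⟩ := hq
    exact ⟨p' + q', fun k => by simp [hp, hq, Finset.sum_add_distrib]⟩
  | monomial m a =>
    refine ⟨Polynomial.C a * ∑ i ∈ Finset.range (m + 1),
      Polynomial.C (bernoulli i * ((m + 1).choose i) / (m + 1)) * Polynomial.X ^ (m + 1 - i),
      fun k => ?_⟩
    simp only [Polynomial.eval_monomial, ← Finset.mul_sum, sum_range_pow]
    simp only [Polynomial.eval_mul, Polynomial.eval_C, Polynomial.eval_finsetSum,
      Polynomial.eval_pow, Polynomial.eval_X]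
    congr 1
    refine Finset.sum_congr rfl fun i _ => ?_
    ring

theorem EventuallyPolynomial.of_shift_sub {f : ℕ → ℚ}
    (hf : EventuallyPolynomial fun k => f (k + 1) - f k) : EventuallyPolynomial f := by
  obtain ⟨p, hp⟩ := hf
  obtain ⟨k₀, hk₀⟩ := eventually_atTop.1 hp
  obtain ⟨q, hq⟩ := exists_polynomial_eval_eq_sum_range p
  refine ⟨q + Polynomial.C (f k₀ - q.eval (k₀ : ℚ)), eventually_atTop.2 ⟨k₀, fun k hk => ?_⟩⟩
  induction k, hk using Nat.le_induction with
  | base => simp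
  | succ k hk ih =>
    have h1 := hk₀ k hk
    have h2 := hq (k + 1)
    rw [Finset.sum_range_succ, ← hq k] at h2
    simp only [Polynomial.eval_add, Polynomial.eval_C] at ih ⊢
    rw [h2]
    linarith

section HilbertSerre

variable {K E ι : Type*} [Field K] [AddCommGroup E] [Module K E]

/-- The subspaces `W k` are mapped to each other by the operators `Y i`. -/
def IsStable (Y : ι → E →ₗ[K] E) (s : Finset ι) (W : ℕ → Submodule K E) : Prop :=
  ∀ i ∈ s, ∀ k, ∀ v ∈ W k, Y i v ∈ W (k + 1)

/-- Every family of subspaces between `U` and `V` which is stable under the operators `Y i` is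
generated over `U` in bounded degrees. -/
def IsNoetherianPair (Y : ι → E →ₗ[K] E) (s : Finset ι) (U V : ℕ → Submodule K E) : Prop :=
  ∀ W : ℕ → Submodule K E, (∀ k, U k ≤ W k) → (∀ k, W k ≤ V k) → IsStable Y s W →
    ∀ᶠ k in atTop, W (k + 1) ≤ U (k + 1) ⊔ ⨆ i ∈ s, (W k).map (Y i)

theorem finrank_map_add_finrank_inf_ker {E' : Type*} [AddCommGroup E'] [Module K E']
    (V : Submodule K E) (Y : E →ₗ[K] E') [FiniteDimensional K V] :
    Module.finrank K ↥(V.map Y) + Module.finrank K ↥(V ⊓ LinearMap.ker Y) =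
      Module.finrank K V := by
  rw [← (Y.domRestrict V).finrank_range_add_finrank_ker, LinearMap.range_domRestrict,
    LinearMap.ker_domRestrict, ← Submodule.map_comap_subtype]
  exact congrArg _ (LinearEquiv.finrank_eq (Submodule.equivMapOfInjective V.subtype
    V.subtype_injective ((LinearMap.ker Y).comap V.subtype))).symm

theorem finrank_comap_add_finrank_sup_map {U V : Submodule K E} (Y : E →ₗ[K] E)
    [FiniteDimensional K V] [FiniteDimensional K U] :
    Module.finrank K V + Module.finrank K U =
      Module.finrank K ↥(V ⊓ U.comap Y) + Module.finrank K ↥(U ⊔ V.map Y) := by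
  have h1 := Submodule.finrank_sup_add_finrank_inf_eq U (V.map Y)
  have h2 := finrank_map_add_finrank_inf_ker V Y
  have : FiniteDimensional K ↥(V ⊓ U.comap Y) := Submodule.finiteDimensional_inf_left _ _
  have h3 := finrank_map_add_finrank_inf_ker (V ⊓ U.comap Y) Y
  have h4 : (V ⊓ U.comap Y).map Y = U ⊓ V.map Y := by
    ext x
    constructor
    · rintro ⟨v, ⟨hv, hv'⟩, rfl⟩
      exact ⟨hv', v, hv, rfl⟩
    · rintro ⟨hx, v, hv, rfl⟩
      exact ⟨v, ⟨hv, hx⟩, rfl⟩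
  have h5 : V ⊓ U.comap Y ⊓ LinearMap.ker Y = V ⊓ LinearMap.ker Y := by
    rw [inf_assoc]
    congr 1
    exact inf_eq_right.2 (LinearMap.ker_le_comap _)
  rw [h4, h5] at h3
  omega

/-- The Hilbert polynomial of a family of subquotients. -/
theorem IsNoetherianPair.eventuallyPolynomial (Y : ι → E →ₗ[K] E)
    (hY : ∀ i j v, Y i (Y j v) = Y j (Y i v)) (s : Finset ι) :
    ∀ U V : ℕ → Submodule K E, (∀ k, U k ≤ V k) → (∀ k, FiniteDimensional K (V k)) →
      IsStable Y s U → IsStable Y s V → IsNoetherianPair Y s U V →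
      EventuallyPolynomial fun k => (Module.finrank K (V k) : ℚ) - Module.finrank K (U k) := by
  classical
  induction s using Finset.induction_on with
  | empty =>
    intro U V hUV _ _ hV h
    refine ⟨0, ?_⟩
    have h1 := h V hUV (fun _ => le_rfl) hV
    obtain ⟨k₀, hk₀⟩ := eventually_atTop.1 h1
    refine eventually_atTop.2 ⟨k₀ + 1, fun k hk => ?_⟩
    obtain ⟨k, rfl⟩ := Nat.exists_eq_add_of_le' (show 1 ≤ k by omega)
    have h2 := hk₀ k (by omega)
    simp only [Finset.notMem_empty, iSup_false, iSup_bot, sup_bot_eq] at h2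
    simp [(LinearEquiv.ofEq _ _ (le_antisymm h2 (hUV _))).finrank_eq]
  | insert a s ha ih =>
    intro U V hUV hfin hU hV h
    have hfinU : ∀ k, FiniteDimensional K (U k) := fun k =>
      Submodule.finiteDimensional_of_le (hUV k)
    let V' : ℕ → Submodule K E := fun k => V k ⊓ (U (k + 1)).comap (Y a)
    let U' : ℕ → Submodule K E := fun k =>
      U k ⊔ Nat.casesOn k ⊥ fun k => (V k).map (Y a)
    have hU'V : ∀ k, U' k ≤ V k := by
      rintro (_ | k)
      · simpa [U'] using hUV 0
      · refine sup_le (hUV _) ?_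
        rintro _ ⟨v, hv, rfl⟩
        exact hV a (Finset.mem_insert_self _ _) k v hv
    have hUV' : ∀ k, U k ≤ V' k := fun k =>
      le_inf (hUV k) fun v hv => hU a (Finset.mem_insert_self _ _) k v hv
    have hker : EventuallyPolynomial fun k =>
        (Module.finrank K (V' k) : ℚ) - Module.finrank K (U k) := by
      refine ih U V' hUV' (fun k => Submodule.finiteDimensional_of_le (inf_le_left : _ ≤ V k))
        (fun i hi => hU i (Finset.mem_insert_of_mem hi)) ?_ ?_
      · rintro i hi k v ⟨hv, hv'⟩
        refine ⟨hV i (Finset.mem_insert_of_mem hi) k v hv, ?_⟩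
        rw [SetLike.mem_coe, Submodule.mem_comap, hY]
        exact hU i (Finset.mem_insert_of_mem hi) _ _ hv'
      · intro W hUW hWV' hW
        filter_upwards [h W hUW (fun k => (hWV' k).trans inf_le_left) (by
          intro i hi k v hv
          rcases Finset.mem_insert.1 hi with rfl | hi
          · exact hUW _ (hWV' _ hv).2
          · exact hW i hi k v hv)] with k hk
        refine hk.trans (sup_le le_sup_left (iSup₂_le fun i hi => ?_))
        rcases Finset.mem_insert.1 hi with rfl | hi
        · refine le_trans ?_ le_sup_left
          rintro _ ⟨v, hv, rfl⟩
          exact (hWV' _ hv).2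
        · exact le_trans (le_iSup₂_of_le i hi le_rfl) le_sup_right
    have hcoker : EventuallyPolynomial fun k =>
        (Module.finrank K (V k) : ℚ) - Module.finrank K (U' k) := by
      refine ih U' V hU'V hfin ?_ (fun i hi => hV i (Finset.mem_insert_of_mem hi)) ?_
      · intro i hi k v hv
        have hi' := Finset.mem_insert_of_mem (a := i) (b := a) hi
        obtain ⟨u, hu, w, hw, rfl⟩ := Submodule.mem_sup.1 hv
        rw [map_add]
        refine add_mem (Submodule.mem_sup_left (hU i hi' k u hu)) (Submodule.mem_sup_right ?_)
        cases k with
        | zero =>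
          have hw0 : w = 0 := hw
          rw [hw0, map_zero]
          exact zero_mem _
        | succ k =>
          obtain ⟨w, hw, rfl⟩ := hw
          rw [hY]
          exact ⟨_, hV i hi' k w hw, rfl⟩
      · intro W hUW hWV hW
        have hW' : IsStable Y (insert a s) W := by
          intro i hi k v hv
          rcases Finset.mem_insert.1 hi with rfl | hi
          · exact hUW _ (Submodule.mem_sup_right ⟨v, hWV _ hv, rfl⟩)
          · exact hW i hi k v hv
        filter_upwards [h W (fun k => le_sup_left.trans (hUW k)) hWV hW'] with k hk
        refine hk.trans (sup_le (le_sup_left.trans le_sup_left) (iSup₂_le fun i hi => ?_))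
        rcases Finset.mem_insert.1 hi with rfl | hi
        · exact (Submodule.map_mono (hWV k)).trans (le_sup_right.trans le_sup_left)
        · exact le_trans (le_iSup₂_of_le i hi le_rfl) le_sup_right
    refine EventuallyPolynomial.of_shift_sub ?_
    convert hcoker.shift.sub hker using 2 with k
    have := finrank_comap_add_finrank_sup_map (U := U (k + 1)) (V := V k) (Y a)
    have h' : (Module.finrank K (V k) : ℚ) + Module.finrank K (U (k + 1)) =
      Module.finrank K (V' k) + Module.finrank K (U' (k + 1)) := mod_cast this
    linarith

end HilbertSerre
end BoijSoederberg

namespace BoijSoederberg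

open MvPolynomial

section GradedNoetherian

variable {K σ ι S β : Type*} [Field K] [CommRing S] [Algebra K S] [Finite σ] [Finite β]
  [AddCommMonoid ι]

/-- A family of graded pieces inside a finitely generated multigraded module over a polynomial ring
is generated in finitely many degrees. -/
theorem exists_finite_generating_degrees (w : σ → ι) (θ : MvPolynomial σ K →ₐ[K] S)
    (W : ι → Submodule K (β → S))
    (hW : ∀ d, ∀ c ∈ W d, ∀ b, c b ∈ (weightedHomogeneousSubmodule K w d).map θ.toLinearMap)
    (hst : ∀ s d, ∀ c ∈ W d, θ (X s) • c ∈ W (d + w s)) :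
    ∃ F : Set ι, F.Finite ∧ ∀ d ∉ F, ∀ c ∈ W d, c ∈ Submodule.span K
      {c' | ∃ s d', d' + w s = d ∧ ∃ v ∈ W d', c' = θ (X s) • v} := by
  classical
  let φ : (β → MvPolynomial σ K) →ₗ[K] (β → S) := θ.toLinearMap.compLeft β
  have hφ : ∀ (t : MvPolynomial σ K) v, φ (t • v) = θ t • φ v := by
    intro t v
    funext b
    simp [φ]
  let hom : ι → Set (β → MvPolynomial σ K) := fun d => {v | ∀ b, IsWeightedHomogeneous w (v b) d}
  let H : Set (β → MvPolynomial σ K) := {v | ∃ d, v ∈ hom d ∧ φ v ∈ W d}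
  have hfg : (Submodule.span (MvPolynomial σ K) H).FG := IsNoetherian.noetherian _
  obtain ⟨G, hGH, hG⟩ := (Submodule.fg_span_iff_fg_span_finset_subset H).1 hfg
  have hGH' : ∀ g ∈ G, ∃ d, g ∈ hom d ∧ φ g ∈ W d := fun g hg => hGH hg
  choose! D hD using hGH'
  refine ⟨D '' G, G.finite_toSet.image _, fun d hd c hc => ?_⟩
  have hlift : ∃ v ∈ hom d, φ v = c := by
    choose v hv using hW d c hc
    exact ⟨v, fun b => (hv b).1, funext fun b => (hv b).2⟩
  obtain ⟨v, hv, rfl⟩ := hlift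
  have hmon : ∀ (a : σ →₀ ℕ) g d', g ∈ hom d' → φ g ∈ W d' →
      monomial a (1 : K) • g ∈ hom (d' + Finsupp.weight w a) ∧
      φ (monomial a (1 : K) • g) ∈ W (d' + Finsupp.weight w a) := by
    intro a
    induction a using Finsupp.induction_linear with
    | zero => intro g d' h1 h2; simpa using ⟨h1, h2⟩
    | add a a' ih ih' =>
      intro g d' h1 h2
      obtain ⟨h3, h4⟩ := ih g d' h1 h2
      have := ih' _ _ h3 h4
      rwa [smul_smul, monomial_mul, mul_one, add_comm a' a, add_assoc, ← map_add] at this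
    | single s m =>
      induction m with
      | zero => intro g d' h1 h2; simpa using ⟨h1, h2⟩
      | succ m ih =>
        intro g d' h1 h2
        obtain ⟨h3, h4⟩ := ih g d' h1 h2
        have e1 : monomial (Finsupp.single s (m + 1)) (1 : K) • g
            = (X s : MvPolynomial σ K) • (monomial (Finsupp.single s m) (1 : K) • g) := by
          rw [smul_smul, X, monomial_mul, mul_one, add_comm m 1, Finsupp.single_add]
        have e2 : d' + Finsupp.weight w (Finsupp.single s (m + 1))
            = d' + Finsupp.weight w (Finsupp.single s m) + w s := by
          rw [Finsupp.single_add, map_add, ← add_assoc]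
          simp [Finsupp.weight_apply]
        rw [e1, e2, hφ]
        refine ⟨fun b => ?_, hst _ _ _ h4⟩
        have := (isWeightedHomogeneous_X K w s).mul (h3 b)
        rw [add_comm] at this
        exact this
  have hvspan : v ∈ Submodule.span K
      {x | ∃ a : σ →₀ ℕ, ∃ g ∈ G, x = monomial a (1 : K) • g} := by
    have h1 : v ∈ Submodule.span (MvPolynomial σ K) (G : Set (β → MvPolynomial σ K)) := by
      rw [← hG]
      exact Submodule.subset_span ⟨d, hv, hc⟩
    rw [← Submodule.restrictScalars_mem K,
      ← Submodule.span_smul_of_span_eq_top (s := Set.range fun a : σ →₀ ℕ => monomial a (1 : K))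
        (by simpa using (basisMonomials σ K).span_eq)] at h1
    refine Submodule.span_mono ?_ h1
    rintro _ ⟨_, ⟨a, rfl⟩, g, hg, rfl⟩
    exact ⟨a, g, hg, rfl⟩
  let π : (β → MvPolynomial σ K) →ₗ[K] (β → MvPolynomial σ K) :=
    (weightedHomogeneousComponent w d).compLeft β
  have hπv : π v = v := funext fun b => (hv b).weightedHomogeneousComponent_same
  rw [← hπv]
  have := Submodule.mem_map_of_mem (f := φ ∘ₗ π) hvspan
  rw [Submodule.map_span] at this
  refine Submodule.span_le.2 ?_ this
  rintro _ ⟨_, ⟨a, g, hg, rfl⟩, rfl⟩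
  obtain ⟨h1, h2⟩ := hD g hg
  have h3 := (hmon a g _ h1 h2).1
  by_cases hdd : D g + Finsupp.weight w a = d
  · have hp : π (monomial a (1 : K) • g) = monomial a (1 : K) • g := by
      rw [hdd] at h3
      exact funext fun b => (h3 b).weightedHomogeneousComponent_same
    have ha : a ≠ 0 := by
      rintro rfl
      exact hd ⟨g, hg, by simpa using hdd⟩
    obtain ⟨s, hs⟩ := Finsupp.ne_iff.1 ha
    obtain ⟨a', rfl⟩ : ∃ a', a = a' + Finsupp.single s 1 :=
      ⟨a - Finsupp.single s 1, by
        rw [tsub_add_cancel_of_le]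
        exact Finsupp.single_le_iff.2 (Nat.one_le_iff_ne_zero.2 hs)⟩
    refine Submodule.subset_span ⟨s, D g + Finsupp.weight w a', ?_, _, (hmon a' g _ h1 h2).2, ?_⟩
    · rw [← hdd, map_add, add_assoc]
      simp [Finsupp.weight_apply]
    · rw [LinearMap.comp_apply, hp, ← hφ, smul_smul, X, monomial_mul, mul_one, add_comm]
  · have hp : π (monomial a (1 : K) • g) = 0 := by
      refine funext fun b => ?_
      exact (h3 b).weightedHomogeneousComponent_ne _ (Ne.symm hdd)
    rw [LinearMap.comp_apply, hp, map_zero]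
    exact zero_mem _

end GradedNoetherian
end BoijSoederberg

namespace BoijSoederberg

section Koszul

/-- The subsets of `{0, …, t - 1}`, as basis of the Koszul complex on `t` elements. -/
def KoszulIndex : ℕ → Type
  | 0 => Unit
  | t + 1 => KoszulIndex t ⊕ KoszulIndex t

instance KoszulIndex.instFinite : ∀ t, Finite (KoszulIndex t)
  | 0 => inferInstanceAs (Finite Unit)
  | t + 1 => by
    have := KoszulIndex.instFinite t
    exact inferInstanceAs (Finite (KoszulIndex t ⊕ KoszulIndex t))

/-- The number of elements of a subset. -/
def KoszulIndex.card : ∀ {t : ℕ}, KoszulIndex t → ℕ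
  | 0, _ => 0
  | _ + 1, .inl b => KoszulIndex.card b
  | _ + 1, .inr b => KoszulIndex.card b + 1

theorem KoszulIndex.card_le : ∀ {t : ℕ} (b : KoszulIndex t), b.card ≤ t
  | 0, _ => le_rfl
  | _ + 1, .inl b => (KoszulIndex.card_le b).trans (Nat.le_succ _)
  | _ + 1, .inr b => Nat.succ_le_succ (KoszulIndex.card_le b)

variable {R : Type*} [CommRing R] (x : ℕ → R) {E E' : Type*} [AddCommGroup E] [Module R E]
  [AddCommGroup E'] [Module R E']

/-- Restriction to the subsets which do not contain the last element. -/
def koszulLeft {t : ℕ} : (KoszulIndex (t + 1) → E) →ₗ[R] (KoszulIndex t → E) :=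
  LinearMap.funLeft R E Sum.inl

/-- Restriction to the subsets which contain the last element. -/
def koszulRight {t : ℕ} : (KoszulIndex (t + 1) → E) →ₗ[R] (KoszulIndex t → E) :=
  LinearMap.funLeft R E Sum.inr

/-- The inverse of the two restrictions. -/
def koszulPair {t : ℕ} :
    (KoszulIndex t → E) × (KoszulIndex t → E) →ₗ[R] (KoszulIndex (t + 1) → E) :=
  (LinearEquiv.sumArrowLequivProdArrow _ _ R E).symm.toLinearMap

@[simp] theorem koszulLeft_pair {t : ℕ} (c : (KoszulIndex t → E) × (KoszulIndex t → E)) :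
    koszulLeft (R := R) (koszulPair (R := R) c) = c.1 := rfl

@[simp] theorem koszulRight_pair {t : ℕ} (c : (KoszulIndex t → E) × (KoszulIndex t → E)) :
    koszulRight (R := R) (koszulPair (R := R) c) = c.2 := rfl

theorem koszul_ext {t : ℕ} {c c' : KoszulIndex (t + 1) → E}
    (h1 : koszulLeft (R := R) c = koszulLeft (R := R) c')
    (h2 : koszulRight (R := R) c = koszulRight (R := R) c') : c = c' := by
  funext b
  rcases b with b | b
  · exact congrFun h1 b
  · exact congrFun h2 b

/-- The differential of the Koszul complex of `x 0, …, x (t - 1)` with coefficients in `E`. -/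
def koszulD : ∀ t : ℕ, (KoszulIndex t → E) →ₗ[R] (KoszulIndex t → E)
  | 0 => 0
  | t + 1 => koszulPair ∘ₗ LinearMap.prod
      (koszulD t ∘ₗ koszulLeft + x t • koszulRight) (-(koszulD t ∘ₗ koszulRight))

@[simp] theorem koszulLeft_koszulD {t : ℕ} (c : KoszulIndex (t + 1) → E) :
    koszulLeft (R := R) (koszulD x (t + 1) c) =
      koszulD x t (koszulLeft (R := R) c) + x t • koszulRight (R := R) c := rfl

@[simp] theorem koszulRight_koszulD {t : ℕ} (c : KoszulIndex (t + 1) → E) :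
    koszulRight (R := R) (koszulD x (t + 1) c) = -koszulD x t (koszulRight (R := R) c) := rfl

@[simp] theorem koszulD_koszulD {t : ℕ} (c : KoszulIndex t → E) :
    koszulD x t (koszulD x t c) = 0 := by
  induction t with
  | zero => rfl
  | succ t ih => apply koszul_ext (R := R) <;> simp [ih]

theorem koszulD_map (f : E →ₗ[R] E') {t : ℕ} (c : KoszulIndex t → E) :
    koszulD x t (fun b => f (c b)) = fun b => f (koszulD x t c b) := by
  induction t with
  | zero => funext b; exact (map_zero f).symm
  | succ t ih =>
    apply koszul_ext (R := R)
    · have := ih (koszulLeft (R := R) c)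
      funext b
      have h := congrFun this b
      rw [koszulLeft_koszulD]
      change koszulD x t (fun b => f (koszulLeft (R := R) c b)) b
        + x t • f (koszulRight (R := R) c b)
        = f (koszulLeft (R := R) (koszulD x (t + 1) c) b)
      rw [h, koszulLeft_koszulD, Pi.add_apply, map_add, Pi.smul_apply, map_smul]
    · have := ih (koszulRight (R := R) c)
      funext b
      have h := congrFun this b
      rw [koszulRight_koszulD]
      change -koszulD x t (fun b => f (koszulRight (R := R) c b)) b
        = f (koszulRight (R := R) (koszulD x (t + 1) c) b)
      rw [h, koszulRight_koszulD, Pi.neg_apply, map_neg]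

theorem koszulD_apply_mem_span {t : ℕ} (c : KoszulIndex t → R) (b : KoszulIndex t) :
    koszulD x t c b ∈ Ideal.span (x '' Set.Iio t) := by
  induction t with
  | zero => exact zero_mem _
  | succ t ih =>
    have hmono : Ideal.span (x '' Set.Iio t) ≤ Ideal.span (x '' Set.Iio (t + 1)) :=
      Ideal.span_mono (Set.image_mono (Set.Iio_subset_Iio (Nat.le_succ t)))
    rcases b with b | b
    · exact add_mem (hmono (ih (koszulLeft (R := R) c) b))
        (Ideal.mul_mem_right _ _ (Ideal.subset_span ⟨t, Nat.lt_succ_self t, rfl⟩))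
    · exact neg_mem (hmono (ih (koszulRight (R := R) c) b))

/-- Exterior multiplication by the `i`-th basis vector. -/
def koszulWedge (i : ℕ) : ∀ t : ℕ, (KoszulIndex t → E) →ₗ[R] (KoszulIndex t → E)
  | 0 => 0
  | t + 1 => if t = i then koszulPair ∘ₗ LinearMap.prod 0 koszulLeft else
      koszulPair ∘ₗ LinearMap.prod (koszulWedge i t ∘ₗ koszulLeft)
        (-(koszulWedge i t ∘ₗ koszulRight))

theorem koszulD_wedge_add {i t : ℕ} (hi : i < t) (c : KoszulIndex t → E) :
    koszulD x t (koszulWedge (R := R) i t c) + koszulWedge (R := R) i t (koszulD x t c)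
      = x i • c := by
  induction t with
  | zero => omega
  | succ t ih =>
    by_cases h : t = i
    · subst h
      apply koszul_ext (R := R) <;> simp [koszulWedge]
    · have ih' := ih (by omega)
      apply koszul_ext (R := R)
      · simp only [koszulWedge, if_neg h, LinearMap.comp_apply, LinearMap.prod_apply, Function.prod,
          map_add, koszulLeft_koszulD, koszulLeft_pair, koszulRight_pair, LinearMap.neg_apply,
          map_smul, ← ih']
        abel_nf
        simp
      · simp only [koszulWedge, if_neg h, LinearMap.comp_apply, LinearMap.prod_apply, Function.prod,
          map_add, koszulRight_koszulD, koszulRight_pair, LinearMap.neg_apply,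
          map_smul, ← ih', map_neg, neg_neg]

section Graded

variable {K : Type*} [Field K] [Module K E]

/-- The component of homological degree `p` and internal degree `j` of the Koszul complex with
coefficients in a family of subspaces `G d` of `E`. -/
def koszulC (G : ℤ → Submodule K E) (t p : ℕ) (j : ℤ) : Submodule K (KoszulIndex t → E) where
  carrier := {c | ∀ b : KoszulIndex t, (b.card = p → c b ∈ G (j - p)) ∧ (b.card ≠ p → c b = 0)}
  zero_mem' := fun _ => ⟨fun _ => zero_mem _, fun _ => rfl⟩
  add_mem' := fun {c c'} hc hc' b => ⟨fun h => add_mem ((hc b).1 h) ((hc' b).1 h), fun h => by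
    rw [Pi.add_apply, (hc b).2 h, (hc' b).2 h, add_zero]⟩
  smul_mem' := fun a c hc b => ⟨fun h => Submodule.smul_mem _ a ((hc b).1 h), fun h => by
    rw [Pi.smul_apply, (hc b).2 h, smul_zero]⟩

variable {G : ℤ → Submodule K E}

theorem koszulC_apply_mem {t p : ℕ} {j : ℤ} {c : KoszulIndex t → E} (hc : c ∈ koszulC G t p j)
    (b : KoszulIndex t) : c b ∈ G (j - p) := by
  by_cases h : b.card = p
  · exact (hc b).1 h
  · rw [(hc b).2 h]
    exact zero_mem _

theorem mem_koszulC_succ {t p : ℕ} {j : ℤ} {c : KoszulIndex (t + 1) → E} :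
    c ∈ koszulC G (t + 1) (p + 1) j ↔
      koszulLeft (R := R) c ∈ koszulC G t (p + 1) j ∧
      koszulRight (R := R) c ∈ koszulC G t p (j - 1) := by
  have e : j - 1 - p = j - (p + 1 : ℕ) := by push_cast; ring
  constructor
  · intro h
    refine ⟨fun b => h (Sum.inl b), fun b => ?_⟩
    rw [e]
    have := h (Sum.inr b)
    exact ⟨fun hb => this.1 (congrArg (· + 1) hb), fun hb => this.2 fun hb' => hb
      (Nat.succ_injective hb')⟩
  · rintro ⟨h1, h2⟩ (b | b)
    · exact h1 b
    · have := h2 b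
      rw [e] at this
      exact ⟨fun hb => this.1 (Nat.succ_injective hb), fun hb => this.2 fun hb' => hb
        (congrArg (· + 1) hb')⟩

theorem mem_koszulC_zero {t : ℕ} {j : ℤ} {c : KoszulIndex (t + 1) → E} :
    c ∈ koszulC G (t + 1) 0 j ↔
      koszulLeft (R := R) c ∈ koszulC G t 0 j ∧ koszulRight (R := R) c = 0 := by
  constructor
  · intro h
    exact ⟨fun b => h (Sum.inl b), funext fun b => (h (Sum.inr b)).2 (Nat.succ_ne_zero _)⟩
  · rintro ⟨h1, h2⟩ (b | b)
    · exact h1 b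
    · exact ⟨fun hb => absurd hb (Nat.succ_ne_zero _), fun _ => congrFun h2 b⟩

theorem koszulD_eq_zero {t : ℕ} {j : ℤ} {c : KoszulIndex t → E} (hc : c ∈ koszulC G t 0 j) :
    koszulD x t c = 0 := by
  induction t with
  | zero => rfl
  | succ t ih =>
    rw [mem_koszulC_zero (R := R)] at hc
    apply koszul_ext (R := R) <;> simp [ih hc.1, hc.2]

theorem koszulWedge_mem (i : ℕ) {t p : ℕ} {j : ℤ} {c : KoszulIndex t → E}
    (hc : c ∈ koszulC G t p j) :
    koszulWedge (R := R) i t c ∈ koszulC G t (p + 1) (j + 1) := by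
  induction t generalizing p j with
  | zero => exact zero_mem _
  | succ t ih =>
    have hl : koszulLeft (R := R) c ∈ koszulC G t p j := fun b => hc (Sum.inl b)
    rw [mem_koszulC_succ (R := R), add_sub_cancel_right]
    by_cases h : t = i
    · simp only [koszulWedge, if_pos h, LinearMap.comp_apply, LinearMap.prod_apply, Function.prod,
        koszulLeft_pair, koszulRight_pair, LinearMap.zero_apply]
      exact ⟨zero_mem _, hl⟩
    · simp only [koszulWedge, if_neg h, LinearMap.comp_apply, LinearMap.prod_apply, Function.prod,
        koszulLeft_pair, koszulRight_pair, LinearMap.neg_apply]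
      refine ⟨ih hl, neg_mem ?_⟩
      cases p with
      | zero =>
        rw [((mem_koszulC_zero (R := R)).1 hc).2, map_zero]
        exact zero_mem _
      | succ p => simpa using ih ((mem_koszulC_succ (R := R)).1 hc).2

theorem koszulD_mem {x : ℕ → R} (hx : ∀ i d, ∀ v ∈ G d, x i • v ∈ G (d + 1)) {t p : ℕ} {j : ℤ}
    {c : KoszulIndex t → E} (hc : c ∈ koszulC G t (p + 1) j) :
    koszulD x t c ∈ koszulC G t p j := by
  induction t generalizing p j with
  | zero => exact zero_mem _
  | succ t ih =>
    rw [mem_koszulC_succ (R := R)] at hc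
    have h1 : x t • koszulRight (R := R) c ∈ koszulC G t p j := fun b => ⟨fun hb => by
      have := hx t _ _ ((hc.2 b).1 hb)
      rwa [show j - 1 - p + 1 = j - p by ring] at this, fun hb => by
      rw [Pi.smul_apply, (hc.2 b).2 hb, smul_zero]⟩
    have h2 := add_mem (ih hc.1) h1
    cases p with
    | zero =>
      rw [mem_koszulC_zero (R := R), koszulLeft_koszulD, koszulRight_koszulD]
      exact ⟨h2, by rw [koszulD_eq_zero x hc.2, neg_zero]⟩
    | succ p =>
      rw [mem_koszulC_succ (R := R), koszulLeft_koszulD, koszulRight_koszulD]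
      exact ⟨h2, neg_mem (ih hc.2)⟩

variable [Algebra K R] [IsScalarTower K R E]

/-- Exactness of the Koszul complex of a regular sequence in positive degrees, and the description
of its boundaries in degree `0`. -/
theorem koszul_acyclic {n : ℕ}
    (hreg : ∀ i < n, ∀ f, x i * f ∈ Ideal.span (x '' Set.Iio i) →
      f ∈ Ideal.span (x '' Set.Iio i)) {t : ℕ} (ht : t ≤ n) :
    (∀ p j, ∀ c ∈ koszulC (K := K) (E := R) (fun _ => ⊤) t (p + 1) j, koszulD x t c = 0 →
      ∃ c' ∈ koszulC (K := K) (E := R) (fun _ => ⊤) t (p + 2) j, koszulD x t c' = c) ∧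
    (∀ j, ∀ c ∈ koszulC (K := K) (E := R) (fun _ => ⊤) t 0 j,
      (∀ b, c b ∈ Ideal.span (x '' Set.Iio t)) →
      ∃ c' ∈ koszulC (K := K) (E := R) (fun _ => ⊤) t 1 j, koszulD x t c' = c) := by
  induction t with
  | zero =>
    constructor
    · intro p j c hc _
      refine ⟨0, zero_mem _, ?_⟩
      rw [map_zero]
      funext b
      exact ((hc b).2 (Nat.succ_ne_zero p).symm).symm
    · intro j c _ hc
      refine ⟨0, zero_mem _, ?_⟩
      rw [map_zero]
      funext b
      simpa [eq_comm] using hc b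
  | succ t ih =>
    obtain ⟨ih1, ih2⟩ := ih (by omega)
    have hsmul : ∀ {p j c}, c ∈ koszulC (K := K) (E := R) (fun _ => ⊤) t p (j - 1) →
        x t • c ∈ koszulC (K := K) (E := R) (fun _ => ⊤) t p j := fun h b =>
      ⟨fun _ => Submodule.mem_top, fun hb => by rw [Pi.smul_apply, (h b).2 hb, smul_zero]⟩
    constructor
    · intro p j c hc hD
      rw [mem_koszulC_succ (R := R)] at hc
      have hl := congrArg (koszulLeft (R := R)) hD
      have hr := congrArg (koszulRight (R := R)) hD
      rw [koszulLeft_koszulD, map_zero] at hl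
      rw [koszulRight_koszulD, map_zero, neg_eq_zero] at hr
      obtain ⟨b', hb', hDb'⟩ : ∃ b' ∈ koszulC (K := K) (E := R) (fun _ => ⊤) t (p + 1) (j - 1),
          koszulD x t b' = koszulRight (R := R) c := by
        cases p with
        | zero =>
          refine ih2 _ _ hc.2 fun b => hreg t (by omega) _ ?_
          have h := congrFun hl b
          have h' : x t * koszulRight (R := R) c b = -koszulD x t (koszulLeft (R := R) c) b :=
            (eq_neg_of_add_eq_zero_right h)
          rw [h']
          exact neg_mem (koszulD_apply_mem_span x _ _)
        | succ p => exact ih1 p _ _ hc.2 hr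
      obtain ⟨a', ha', hDa'⟩ := ih1 p j (koszulLeft (R := R) c + x t • b')
        (add_mem hc.1 (hsmul hb')) (by rw [map_add, map_smul, hDb', hl])
      refine ⟨koszulPair (R := R) (a', -b'), ?_, ?_⟩
      · rw [mem_koszulC_succ (R := R)]
        exact ⟨ha', neg_mem hb'⟩
      · apply koszul_ext (R := R) <;> simp [hDa', hDb']
    · intro j c hc hmem
      rw [mem_koszulC_zero (R := R)] at hc
      have : ∀ b : KoszulIndex t, ∃ r, (b.card ≠ 0 → r = 0) ∧
          koszulLeft (R := R) c b - x t * r ∈ Ideal.span (x '' Set.Iio t) := by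
        intro b
        by_cases hb : b.card = 0
        · have h := hmem (Sum.inl b)
          rw [show Set.Iio (t + 1) = insert t (Set.Iio t) by ext; simp, Set.image_insert_eq,
            Ideal.mem_span_insert] at h
          obtain ⟨r, z, hz, e⟩ := h
          refine ⟨r, fun h => absurd hb h, ?_⟩
          change c (Sum.inl b) - _ ∈ _
          rw [e, mul_comm r, add_sub_cancel_left]
          exact hz
        · refine ⟨0, fun _ => rfl, ?_⟩
          rw [(hc.1 b).2 hb, mul_zero, sub_zero]
          exact zero_mem _
      choose r hr hr' using this
      have hrC : r ∈ koszulC (K := K) (E := R) (fun _ => ⊤) t 0 (j - 1) := fun b =>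
        ⟨fun _ => Submodule.mem_top, hr b⟩
      obtain ⟨s, hs, hDs⟩ := ih2 j (koszulLeft (R := R) c - x t • r)
        (sub_mem hc.1 (hsmul hrC)) hr'
      refine ⟨koszulPair (R := R) (s, r), ?_, ?_⟩
      · rw [mem_koszulC_succ (R := R)]
        exact ⟨hs, hrC⟩
      · apply koszul_ext (R := R)
        · simp [hDs]
        · simp [koszulD_eq_zero x hrC, hc.2]

variable (G) in
/-- Koszul cycles. -/
def koszulZ (t p : ℕ) (j : ℤ) : Submodule K (KoszulIndex t → E) :=
  koszulC G t p j ⊓ LinearMap.ker ((koszulD x t).restrictScalars K)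

variable (G) in
/-- Koszul boundaries. -/
def koszulB (t p : ℕ) (j : ℤ) : Submodule K (KoszulIndex t → E) :=
  (koszulC G t (p + 1) j).map ((koszulD x t).restrictScalars K)

variable (G) in
/-- The dimensions of the graded components of Koszul homology. -/
noncomputable def koszulH (t p : ℕ) (j : ℤ) : ℕ :=
  Module.finrank K (koszulZ x G t p j ⧸ (koszulB x G t p j).submoduleOf (koszulZ x G t p j))

theorem koszulB_le_koszulZ {x : ℕ → R} (hx : ∀ i d, ∀ v ∈ G d, x i • v ∈ G (d + 1)) (t p : ℕ)
    (j : ℤ) : koszulB x G t p j ≤ koszulZ x G t p j := by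
  rintro _ ⟨c, hc, rfl⟩
  exact ⟨koszulD_mem hx hc, koszulD_koszulD x c⟩

end Graded
end Koszul
end BoijSoederberg

namespace BoijSoederberg

section Shift

theorem finrank_quotient_eq_of_surjective {K Q F : Type*} [Field K] [AddCommGroup Q] [Module K Q]
    [AddCommGroup F] [Module K F] (f : Q →ₗ[K] F) (hf : Function.Surjective f)
    (P : Submodule K Q) (hP : ∀ q, q ∈ P ↔ f q = 0) :
    Module.finrank K (Q ⧸ P) = Module.finrank K F := by
  obtain rfl : P = LinearMap.ker f := by
    ext q
    exact hP q
  exact (f.quotKerEquivOfSurjective hf).finrank_eq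

/-- If `f` maps `Q` onto `Z`, then `Z / B` is the quotient of `Q` by the preimage of `B`. -/
theorem finrank_quotient_eq_of_map {K E E' : Type*} [Field K] [AddCommGroup E] [Module K E]
    [AddCommGroup E'] [Module K E'] (f : E →ₗ[K] E') (Q P : Submodule K E) (Z B : Submodule K E')
    (hQ : ∀ q ∈ Q, f q ∈ Z) (hZ : ∀ z ∈ Z, ∃ q ∈ Q, f q = z)
    (hP : ∀ q ∈ Q, q ∈ P ↔ f q ∈ B) :
    Module.finrank K (Q ⧸ P.submoduleOf Q) = Module.finrank K (Z ⧸ B.submoduleOf Z) := by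
  refine finrank_quotient_eq_of_surjective ((B.submoduleOf Z).mkQ ∘ₗ f.restrict hQ) ?_ _ ?_
  · refine (Submodule.mkQ_surjective _).comp ?_
    rintro ⟨z, hz⟩
    obtain ⟨q, hq, rfl⟩ := hZ z hz
    exact ⟨⟨q, hq⟩, rfl⟩
  · rintro ⟨q, hq⟩
    rw [LinearMap.comp_apply, Submodule.mkQ_apply, Submodule.Quotient.mk_eq_zero]
    exact hP q hq

variable {R : Type*} [CommRing R] {x : ℕ → R} {E E' : Type*} [AddCommGroup E] [Module R E]
  [AddCommGroup E'] [Module R E'] {K : Type*} [Field K] [Module K E]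
  {G L : ℤ → Submodule K E} {π : E →ₗ[R] E'} {t : ℕ}

theorem koszulC_ker_iff (hL : ∀ d v, v ∈ L d ↔ v ∈ G d ∧ π v = 0) {p : ℕ} {j : ℤ}
    {c : KoszulIndex t → E} :
    c ∈ koszulC L t p j ↔ c ∈ koszulC G t p j ∧ (fun b => π (c b)) = 0 := by
  constructor
  · intro h
    refine ⟨fun b => ⟨fun hb => ((hL _ _).1 ((h b).1 hb)).1, (h b).2⟩, funext fun b => ?_⟩
    exact ((hL _ _).1 (koszulC_apply_mem h b)).2
  · rintro ⟨h1, h2⟩ b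
    exact ⟨fun hb => (hL _ _).2 ⟨(h1 b).1 hb, congrFun h2 b⟩, (h1 b).2⟩

variable [Module K E'] {M : ℤ → Submodule K E'}

theorem map_mem_koszulC (hGM : ∀ d, ∀ v ∈ G d, π v ∈ M d) {p : ℕ} {j : ℤ}
    {c : KoszulIndex t → E} (hc : c ∈ koszulC G t p j) :
    (fun b => π (c b)) ∈ koszulC M t p j := fun b =>
  ⟨fun hb => hGM _ _ ((hc b).1 hb), fun hb => (congrArg π ((hc b).2 hb)).trans (map_zero π)⟩

theorem exists_lift_koszulC (hMG : ∀ d, ∀ m ∈ M d, ∃ v ∈ G d, π v = m) {p : ℕ} {j : ℤ}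
    {c : KoszulIndex t → E'} (hc : c ∈ koszulC M t p j) :
    ∃ c' ∈ koszulC G t p j, (fun b => π (c' b)) = c := by
  have : ∀ b : KoszulIndex t, ∃ v, (b.card = p → v ∈ G (j - p)) ∧ (b.card ≠ p → v = 0) ∧
      π v = c b := by
    intro b
    by_cases hb : b.card = p
    · obtain ⟨v, hv, h⟩ := hMG _ _ ((hc b).1 hb)
      exact ⟨v, fun _ => hv, fun h' => absurd hb h', h⟩
    · exact ⟨0, fun h => absurd h hb, fun _ => rfl, by rw [(hc b).2 hb, map_zero]⟩
  choose c' h1 h2 h3 using this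
  exact ⟨c', fun b => ⟨h1 b, h2 b⟩, funext h3⟩

variable [Algebra K R] [IsScalarTower K R E] [IsScalarTower K R E']

/-- Dimension shift: the Koszul homology of a quotient of a Koszul acyclic module. -/
theorem koszulH_succ_eq_of_ker (hx : ∀ i d, ∀ v ∈ G d, x i • v ∈ G (d + 1))
    (hL : ∀ d v, v ∈ L d ↔ v ∈ G d ∧ π v = 0)
    (hGM : ∀ d, ∀ v ∈ G d, π v ∈ M d) (hMG : ∀ d, ∀ m ∈ M d, ∃ v ∈ G d, π v = m)
    (hac : ∀ p j, koszulZ x G t (p + 1) j ≤ koszulB x G t (p + 1) j)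
    (hmin : ∀ j, koszulC L t 0 j ≤ koszulB x G t 0 j) (p : ℕ) (j : ℤ) :
    koszulH x M t (p + 1) j = koszulH x L t p j := by
  let f : (KoszulIndex t → E) →ₗ[K] (KoszulIndex t → E') := (π.restrictScalars K).compLeft _
  have hf : ∀ c, f c = fun b => π (c b) := fun _ => rfl
  have hfD : ∀ c, f (koszulD x t c) = koszulD x t (f c) := fun c => (koszulD_map x π c).symm
  have hLG : ∀ {p j c}, c ∈ koszulC L t p j ↔ c ∈ koszulC G t p j ∧ f c = 0 :=
    koszulC_ker_iff hL
  let Q : Submodule K (KoszulIndex t → E) := koszulC G t (p + 1) j ⊓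
    LinearMap.ker (f ∘ₗ (koszulD x t).restrictScalars K)
  have hQ : ∀ c, c ∈ Q ↔ c ∈ koszulC G t (p + 1) j ∧ f (koszulD x t c) = 0 := fun _ => Iff.rfl
  have h1 := finrank_quotient_eq_of_map f Q ((koszulB x M t (p + 1) j).comap f)
    (koszulZ x M t (p + 1) j) (koszulB x M t (p + 1) j) (by
      intro c hc
      exact ⟨map_mem_koszulC hGM hc.1, (hfD c).symm.trans hc.2⟩) (by
      rintro z ⟨hz, hz'⟩
      obtain ⟨c, hc, rfl⟩ := exists_lift_koszulC hMG hz
      exact ⟨c, ⟨hc, (hfD c).trans hz'⟩, rfl⟩) (fun _ _ => Iff.rfl)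
  have h2 := finrank_quotient_eq_of_map ((koszulD x t).restrictScalars K) Q
    ((koszulB x M t (p + 1) j).comap f) (koszulZ x L t p j) (koszulB x L t p j) (by
      intro c hc
      exact ⟨hLG.2 ⟨koszulD_mem hx hc.1, hc.2⟩, koszulD_koszulD x c⟩) (by
      rintro z ⟨hz, hz'⟩
      have hz'' := hLG.1 hz
      have : z ∈ koszulB x G t p j := by
        cases p with
        | zero => exact hmin j hz
        | succ p => exact hac p j ⟨hz''.1, hz'⟩
      obtain ⟨c, hc, rfl⟩ := this
      exact ⟨c, ⟨hc, hz''.2⟩, rfl⟩) (by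
      rintro c ⟨hc, hc'⟩
      constructor
      · rintro ⟨m, hm, hmc⟩
        obtain ⟨c', hc', rfl⟩ := exists_lift_koszulC hMG hm
        refine ⟨c - koszulD x t c', hLG.2 ⟨sub_mem hc (koszulD_mem hx hc'), ?_⟩, ?_⟩
        · rw [map_sub, hfD, sub_eq_zero]
          exact hmc.symm
        · simp
      · rintro ⟨l, hl, hlc⟩
        have hl' := hLG.1 hl
        have hlc' : koszulD x t l = koszulD x t c := hlc
        obtain ⟨c', hc', h⟩ := hac p j ⟨sub_mem hc hl'.1, show koszulD x t (c - l) = 0 by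
          rw [map_sub, hlc', sub_self]⟩
        refine ⟨f c', map_mem_koszulC hGM hc', ?_⟩
        have h' : koszulD x t c' = c - l := h
        change koszulD x t (f c') = f c
        rw [← hfD, h', map_sub, hl'.2, sub_zero])
  exact h1.symm.trans h2

theorem koszulZ_zero (j : ℤ) : koszulZ x G t 0 j = koszulC G t 0 j :=
  inf_eq_left.2 fun _ hc => koszulD_eq_zero x hc

theorem koszulH_zero_eq_of_ker (hx : ∀ i d, ∀ v ∈ G d, x i • v ∈ G (d + 1))
    (hL : ∀ d v, v ∈ L d ↔ v ∈ G d ∧ π v = 0)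
    (hGM : ∀ d, ∀ v ∈ G d, π v ∈ M d) (hMG : ∀ d, ∀ m ∈ M d, ∃ v ∈ G d, π v = m)
    (hmin : ∀ j, koszulC L t 0 j ≤ koszulB x G t 0 j) (j : ℤ) :
    koszulH x M t 0 j = koszulH x G t 0 j := by
  let f : (KoszulIndex t → E) →ₗ[K] (KoszulIndex t → E') := (π.restrictScalars K).compLeft _
  have hfD : ∀ c, f (koszulD x t c) = koszulD x t (f c) := fun c => (koszulD_map x π c).symm
  symm
  refine finrank_quotient_eq_of_map f _ _ _ _ ?_ ?_ ?_
  · intro c hc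
    rw [koszulZ_zero] at hc ⊢
    exact map_mem_koszulC hGM hc
  · intro z hz
    rw [koszulZ_zero] at hz ⊢
    exact exists_lift_koszulC hMG hz
  · intro c hc
    rw [koszulZ_zero] at hc
    constructor
    · rintro ⟨c', hc', rfl⟩
      exact ⟨f c', map_mem_koszulC hGM hc', (hfD c').symm⟩
    · rintro ⟨m, hm, hmc⟩
      obtain ⟨c', hc', rfl⟩ := exists_lift_koszulC hMG hm
      have h : c - koszulD x t c' ∈ koszulC L t 0 j := by
        refine (koszulC_ker_iff hL).2 ⟨sub_mem hc (koszulD_mem hx hc'), ?_⟩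
        change f (c - koszulD x t c') = 0
        rw [map_sub, hfD, sub_eq_zero]
        exact hmc.symm
      have h' := add_mem (hmin j h) (show koszulD x t c' ∈ koszulB x G t 0 j from ⟨c', hc', rfl⟩)
      rwa [sub_add_cancel] at h'

end Shift
end BoijSoederberg

namespace BoijSoederberg

open MvPolynomial

section Free

variable {K : Type*} [Field K] {n : ℕ}

variable (K n) in
/-- The forms of degree `d`, for an integer `d`. -/
noncomputable def forms (d : ℤ) : Submodule K (MvPolynomial (Fin n) K) :=
  weightedHomogeneousSubmodule K (fun _ => (1 : ℤ)) d

variable (K n) in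
/-- The projection to the forms of degree `d`. -/
noncomputable def formPart (d : ℤ) : MvPolynomial (Fin n) K →ₗ[K] MvPolynomial (Fin n) K :=
  weightedHomogeneousComponent (fun _ => (1 : ℤ)) d

theorem formPart_mem (d : ℤ) (f : MvPolynomial (Fin n) K) : formPart K n d f ∈ forms K n d :=
  weightedHomogeneousComponent_mem _ _ _

theorem formPart_eq_self {d : ℤ} {f : MvPolynomial (Fin n) K} (hf : f ∈ forms K n d) :
    formPart K n d f = f :=
  weightedHomogeneousComponent_eq_self hf

theorem formPart_eq_zero {d e : ℤ} {f : MvPolynomial (Fin n) K} (hf : f ∈ forms K n e)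
    (hde : d ≠ e) : formPart K n d f = 0 :=
  IsWeightedHomogeneous.weightedHomogeneousComponent_ne d hf hde

theorem weight_one_int (u : Fin n →₀ ℕ) :
    Finsupp.weight (fun _ => (1 : ℤ)) u = (u.degree : ℤ) := by
  simp [Finsupp.weight_apply, Finsupp.degree_apply, Finsupp.sum]

theorem mem_forms_iff {d : ℤ} {f : MvPolynomial (Fin n) K} :
    f ∈ forms K n d ↔ ∀ u, coeff u f ≠ 0 → (u.degree : ℤ) = d := by
  simp only [← weight_one_int]
  rfl

theorem mem_forms_natCast {d : ℕ} {f : MvPolynomial (Fin n) K} :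
    f ∈ forms K n d ↔ f.IsHomogeneous d := by
  rw [mem_forms_iff, IsHomogeneous, IsWeightedHomogeneous]
  simp only [Nat.cast_inj, Finsupp.degree_eq_weight_one]
  rfl

theorem mul_mem_forms {d e : ℤ} {f g : MvPolynomial (Fin n) K} (hf : f ∈ forms K n d)
    (hg : g ∈ forms K n e) : f * g ∈ forms K n (d + e) :=
  IsWeightedHomogeneous.mul hf hg

theorem monomial_mem_forms (u : Fin n →₀ ℕ) (a : K) : monomial u a ∈ forms K n u.degree :=
  isWeightedHomogeneous_monomial _ _ _ (weight_one_int u)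

theorem formPart_mul {e : ℤ} {g : MvPolynomial (Fin n) K} (hg : g ∈ forms K n e) (d : ℤ)
    (s : MvPolynomial (Fin n) K) :
    formPart K n d (s * g) = formPart K n (d - e) s * g := by
  induction s using MvPolynomial.induction_on' with
  | monomial u a =>
    have h := mul_mem_forms (monomial_mem_forms u a) hg
    by_cases hd : d = u.degree + e
    · subst hd
      rw [formPart_eq_self h, add_sub_cancel_right, formPart_eq_self (monomial_mem_forms u a)]
    · rw [formPart_eq_zero h hd, formPart_eq_zero (monomial_mem_forms u a) (by omega), zero_mul]
  | add p q hp hq => rw [add_mul, map_add, map_add, hp, hq, add_mul]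

variable (K n) in
/-- The variables of the polynomial ring, as a sequence. -/
noncomputable def varSeq (i : ℕ) : MvPolynomial (Fin n) K :=
  if h : i < n then X ⟨i, h⟩ else 0

theorem varSeq_mem_forms (i : ℕ) : varSeq K n i ∈ forms K n 1 := by
  rw [varSeq]
  split_ifs
  · exact isWeightedHomogeneous_X _ _ _
  · exact zero_mem _

theorem image_varSeq_Iio {i : ℕ} (hi : i ≤ n) :
    varSeq K n '' Set.Iio i = X '' {a : Fin n | (a : ℕ) < i} := by
  ext f
  constructor
  · rintro ⟨a, ha, rfl⟩
    have ha' : a < i := ha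
    exact ⟨⟨a, by omega⟩, ha', by rw [varSeq, dif_pos]⟩
  · rintro ⟨a, ha, rfl⟩
    exact ⟨a, ha, by rw [varSeq, dif_pos a.2]⟩

theorem varSeq_regular (i : ℕ) (hi : i < n) (f : MvPolynomial (Fin n) K)
    (hf : varSeq K n i * f ∈ Ideal.span (varSeq K n '' Set.Iio i)) :
    f ∈ Ideal.span (varSeq K n '' Set.Iio i) := by
  rw [image_varSeq_Iio hi.le, mem_ideal_span_X_image] at hf ⊢
  intro u hu
  obtain ⟨a, ha, h⟩ := hf (Finsupp.single ⟨i, hi⟩ 1 + u) (by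
    rw [mem_support_iff, varSeq, dif_pos hi, coeff_X_mul]
    exact mem_support_iff.1 hu)
  refine ⟨a, ha, ?_⟩
  have ha' : (⟨i, hi⟩ : Fin n) ≠ a := fun h => by
    have : (a : ℕ) < i := ha
    rw [← h] at this
    exact lt_irrefl _ this
  rwa [Finsupp.add_apply, Finsupp.single_eq_of_ne ha'.symm, zero_add] at h

theorem span_varSeq : Ideal.span (varSeq K n '' Set.Iio n) = idealOfVars (Fin n) K := by
  rw [image_varSeq_Iio le_rfl, idealOfVars, ← Set.image_univ]
  congr 2
  ext a
  simp

theorem mem_idealOfVars_iff_constantCoeff {f : MvPolynomial (Fin n) K} :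
    f ∈ idealOfVars (Fin n) K ↔ constantCoeff f = 0 := by
  rw [← pow_one (idealOfVars (Fin n) K), mem_pow_idealOfVars_iff', constantCoeff_eq]
  constructor
  · intro h
    exact h 0 (by simp)
  · intro h u hu
    rw [(Finsupp.degree_eq_zero_iff u).1 (by omega)]
    exact h

theorem koszulD_formPart (d : ℤ) {t : ℕ} (c : KoszulIndex t → MvPolynomial (Fin n) K) :
    koszulD (varSeq K n) t (fun b => formPart K n d (c b)) =
      fun b => formPart K n (d + 1) (koszulD (varSeq K n) t c b) := by
  induction t with
  | zero => funext b; exact (map_zero _).symm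
  | succ t ih =>
    have hx : ∀ s, formPart K n (d + 1) (varSeq K n t * s) = varSeq K n t * formPart K n d s := by
      intro s
      rw [mul_comm, formPart_mul (varSeq_mem_forms t), add_sub_cancel_right, mul_comm]
    funext b
    rcases b with b | b
    · have h := congrFun (ih (koszulLeft (R := MvPolynomial (Fin n) K) c)) b
      have h' := hx (koszulRight (R := MvPolynomial (Fin n) K) c b)
      change koszulD (varSeq K n) t (fun b => formPart K n d
        (koszulLeft (R := MvPolynomial (Fin n) K) c b)) b + varSeq K n t *
          formPart K n d (koszulRight (R := MvPolynomial (Fin n) K) c b) = _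
      rw [h, ← h', ← map_add]
      rfl
    · have h := congrFun (ih (koszulRight (R := MvPolynomial (Fin n) K) c)) b
      change -koszulD (varSeq K n) t (fun b => formPart K n d
        (koszulRight (R := MvPolynomial (Fin n) K) c b)) b = _
      rw [h, ← map_neg]
      rfl

variable {m : ℕ} (δ : Fin m → ℕ)

variable (K n) in
/-- The homogeneous elements of degree `d` of `⨁ₐ S(-δ a)`. -/
noncomputable def freeForms (d : ℤ) : Submodule K (Fin m → MvPolynomial (Fin n) K) :=
  Submodule.pi Set.univ fun a => forms K n (d - δ a)

theorem mem_freeForms {d : ℤ} {v : Fin m → MvPolynomial (Fin n) K} :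
    v ∈ freeForms K n δ d ↔ ∀ a, v a ∈ forms K n (d - δ a) := by
  simp [freeForms]

theorem varSeq_smul_mem_freeForms (i : ℕ) (d : ℤ) (v : Fin m → MvPolynomial (Fin n) K)
    (hv : v ∈ freeForms K n δ d) : varSeq K n i • v ∈ freeForms K n δ (d + 1) := by
  rw [mem_freeForms] at hv ⊢
  intro a
  have := mul_mem_forms (varSeq_mem_forms i) (hv a)
  rwa [show 1 + (d - δ a) = d + 1 - δ a by ring] at this

theorem koszulD_coord {t : ℕ} (c : KoszulIndex t → Fin m → MvPolynomial (Fin n) K) (a : Fin m) :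
    koszulD (varSeq K n) t (fun b => c b a) = fun b => koszulD (varSeq K n) t c b a :=
  koszulD_map (varSeq K n) (LinearMap.proj (R := MvPolynomial (Fin n) K)
    (φ := fun _ : Fin m => MvPolynomial (Fin n) K) a) c

theorem mem_koszulB_freeForms {t p : ℕ} {j : ℤ}
    {c : KoszulIndex t → Fin m → MvPolynomial (Fin n) K}
    (hc : c ∈ koszulC (freeForms K n δ) t p j)
    (h : ∀ a, ∃ c' ∈ koszulC (K := K) (E := MvPolynomial (Fin n) K) (fun _ => ⊤) t (p + 1) j,
      koszulD (varSeq K n) t c' = fun b => c b a) :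
    c ∈ koszulB (varSeq K n) (freeForms K n δ) t p j := by
  choose c' hc' hD using h
  refine ⟨fun b a => formPart K n (j - (p + 1 : ℕ) - δ a) (c' a b), fun b => ⟨fun _ => ?_,
    fun hb => ?_⟩, ?_⟩
  · rw [mem_freeForms]
    exact fun a => formPart_mem _ _
  · funext a
    simp only [(hc' a b).2 hb, map_zero, Pi.zero_apply]
  · change koszulD (varSeq K n) t _ = c
    funext b a
    have h1 := congrFun (koszulD_coord (fun b a => formPart K n (j - (p + 1 : ℕ) - δ a) (c' a b))
      a) b
    rw [← h1, koszulD_formPart, hD]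
    have h2 := (mem_freeForms δ).1 (koszulC_apply_mem hc b) a
    have e : j - (p + 1 : ℕ) - δ a + 1 = j - p - δ a := by push_cast; ring
    simp only [e]
    exact formPart_eq_self h2

theorem koszulZ_le_koszulB_freeForms (p : ℕ) (j : ℤ) :
    koszulZ (varSeq K n) (freeForms K n δ) n (p + 1) j ≤
      koszulB (varSeq K n) (freeForms K n δ) n (p + 1) j := by
  rintro c ⟨hc, hD⟩
  refine mem_koszulB_freeForms δ hc fun a => ?_
  refine (koszul_acyclic (K := K) (varSeq K n) varSeq_regular le_rfl).1 p j _
    (fun b => ⟨fun _ => Submodule.mem_top, fun hb => by rw [(hc b).2 hb, Pi.zero_apply]⟩) ?_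
  rw [koszulD_coord]
  have hD' : koszulD (varSeq K n) n c = 0 := hD
  rw [hD']
  rfl

theorem koszulC_le_koszulB_freeForms (N : Submodule (MvPolynomial (Fin n) K)
    (Fin m → MvPolynomial (Fin n) K)) (hN : ∀ v ∈ N, ∀ a, v a ∈ idealOfVars (Fin n) K) (j : ℤ) :
    koszulC (fun d => N.restrictScalars K ⊓ freeForms K n δ d) n 0 j ≤
      koszulB (varSeq K n) (freeForms K n δ) n 0 j := by
  intro c hc
  refine mem_koszulB_freeForms δ (fun b => ⟨fun hb => ((hc b).1 hb).2, (hc b).2⟩) fun a => ?_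
  refine (koszul_acyclic (K := K) (varSeq K n) varSeq_regular le_rfl).2 j _
    (fun b => ⟨fun _ => Submodule.mem_top, fun hb => by rw [(hc b).2 hb, Pi.zero_apply]⟩) ?_
  intro b
  rw [span_varSeq]
  exact hN _ (koszulC_apply_mem hc b).1 a

/-- The empty subset. -/
def KoszulIndex.empty : ∀ t : ℕ, KoszulIndex t
  | 0 => ()
  | t + 1 => .inl (KoszulIndex.empty t)

theorem KoszulIndex.card_eq_zero : ∀ {t : ℕ} {b : KoszulIndex t},
    b.card = 0 ↔ b = KoszulIndex.empty t
  | 0, () => ⟨fun _ => rfl, fun _ => rfl⟩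
  | _ + 1, .inl b => (KoszulIndex.card_eq_zero (b := b)).trans Sum.inl_injective.eq_iff.symm
  | _ + 1, .inr _ => ⟨fun h => absurd h (Nat.succ_ne_zero _), fun h => absurd h Sum.inr_ne_inl⟩

theorem koszulH_freeForms_zero (j : ℤ) :
    koszulH (varSeq K n) (freeForms K n δ) n 0 j = Nat.card {a : Fin m // (δ a : ℤ) = j} := by
  let ψ : (KoszulIndex n → Fin m → MvPolynomial (Fin n) K) →ₗ[K]
      ({a : Fin m // (δ a : ℤ) = j} → K) :=
    LinearMap.pi fun a => (lcoeff K 0) ∘ₗ LinearMap.proj (a : Fin m) ∘ₗ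
      LinearMap.proj (KoszulIndex.empty n)
  have hψ : ∀ c a, ψ c a = constantCoeff (c (KoszulIndex.empty n) a) := fun _ _ => rfl
  rw [koszulH, finrank_quotient_eq_of_surjective (ψ.domRestrict _), Module.finrank_pi,
    Nat.card_eq_fintype_card]
  · intro g
    refine ⟨⟨fun b a => if h : b.card = 0 ∧ (δ a : ℤ) = j then C (g ⟨a, h.2⟩) else 0, ?_⟩, ?_⟩
    · rw [koszulZ_zero]
      refine fun b => ⟨fun _ => (mem_freeForms δ).2 fun a => ?_, fun hb => ?_⟩
      · dsimp only
        split_ifs with h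
        · rw [show j - (0 : ℕ) - δ a = 0 by omega]
          exact isWeightedHomogeneous_C _ _
        · exact zero_mem _
      · exact funext fun a => dif_neg fun h => hb h.1
    · funext a
      simp [LinearMap.domRestrict_apply, hψ, KoszulIndex.card_eq_zero.2, a.2]
  · rintro ⟨c, hc⟩
    have hc0 := hc
    rw [koszulZ_zero] at hc
    change c ∈ koszulB _ _ _ _ _ ↔ ψ c = 0
    constructor
    · rintro ⟨c', -, rfl⟩
      funext a
      rw [hψ, Pi.zero_apply, ← mem_idealOfVars_iff_constantCoeff, ← span_varSeq]
      have h := congrFun (koszulD_coord c' a) (KoszulIndex.empty n)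
      change koszulD (varSeq K n) n c' _ _ ∈ _
      rw [← h]
      exact koszulD_apply_mem_span _ _ _
    · intro h
      refine mem_koszulB_freeForms δ hc fun a => ?_
      refine (koszul_acyclic (K := K) (varSeq K n) varSeq_regular le_rfl).2 j _
        (fun b => ⟨fun _ => Submodule.mem_top, fun hb => by rw [(hc b).2 hb, Pi.zero_apply]⟩) ?_
      intro b
      rw [span_varSeq, mem_idealOfVars_iff_constantCoeff]
      by_cases hb : b.card = 0
      · by_cases ha : (δ a : ℤ) = j
        · rw [KoszulIndex.card_eq_zero.1 hb]
          exact congrFun h ⟨a, ha⟩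
        · by_contra hne
          have h1 := mem_forms_iff.1 ((mem_freeForms δ).1 (koszulC_apply_mem hc b) a) 0 hne
          simp at h1
          omega
      · rw [(hc b).2 hb, Pi.zero_apply, map_zero]

end Free
end BoijSoederberg

namespace BoijSoederberg

open MvPolynomial

section Betti

variable {K : Type*} [Field K] {n : ℕ}

/-- The graded pieces of an ideal. -/
noncomputable def idealForms (I : Ideal (MvPolynomial (Fin n) K)) (d : ℤ) :
    Submodule K (MvPolynomial (Fin n) K) :=
  I.restrictScalars K ⊓ forms K n d

/-- The degree `d` component of an element of `⨁ₐ S(-δ a)`. -/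
noncomputable def freePart {m : ℕ} (δ : Fin m → ℕ) (d : ℤ) (v : Fin m → MvPolynomial (Fin n) K) :
    Fin m → MvPolynomial (Fin n) K :=
  fun a => formPart K n (d - δ a) (v a)

theorem freePart_mem {m : ℕ} (δ : Fin m → ℕ) (d : ℤ) (v : Fin m → MvPolynomial (Fin n) K) :
    freePart δ d v ∈ freeForms K n δ d :=
  (mem_freeForms δ).2 fun _ => formPart_mem _ _

theorem linearMap_apply_eq_sum {m : ℕ}
    (f : (Fin m → MvPolynomial (Fin n) K) →ₗ[MvPolynomial (Fin n) K] MvPolynomial (Fin n) K)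
    (v : Fin m → MvPolynomial (Fin n) K) : f v = ∑ b, v b * f (Pi.single b 1) := by
  conv_lhs => rw [pi_eq_sum_univ' v]
  simp [map_sum]

theorem formPart_linearMap {m : ℕ} {δ : Fin m → ℕ} {e : ℤ}
    {f : (Fin m → MvPolynomial (Fin n) K) →ₗ[MvPolynomial (Fin n) K] MvPolynomial (Fin n) K}
    (hf : ∀ b, f (Pi.single b 1) ∈ forms K n (δ b - e)) (d : ℤ)
    (v : Fin m → MvPolynomial (Fin n) K) :
    formPart K n (d - e) (f v) = f (freePart δ d v) := by
  rw [linearMap_apply_eq_sum f v, linearMap_apply_eq_sum f (freePart δ d v), map_sum]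
  refine Finset.sum_congr rfl fun b _ => ?_
  rw [formPart_mul (hf b), freePart]
  congr 2
  congr 1
  ring

theorem linearMap_mem_forms {m : ℕ} {δ : Fin m → ℕ} {e : ℤ}
    {f : (Fin m → MvPolynomial (Fin n) K) →ₗ[MvPolynomial (Fin n) K] MvPolynomial (Fin n) K}
    (hf : ∀ b, f (Pi.single b 1) ∈ forms K n (δ b - e)) {d : ℤ}
    {v : Fin m → MvPolynomial (Fin n) K} (hv : v ∈ freeForms K n δ d) :
    f v ∈ forms K n (d - e) := by
  rw [linearMap_apply_eq_sum f v]
  refine Submodule.sum_mem _ fun b _ => ?_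
  have := mul_mem_forms ((mem_freeForms δ).1 hv b) (hf b)
  rwa [show d - δ b + (δ b - e) = d - e by ring] at this

namespace MinimalGradedFreeResolution

variable {I : Ideal (MvPolynomial (Fin n) K)} (F : MinimalGradedFreeResolution I)

theorem aug_mem (b : Fin (F.rank 0)) : F.aug (Pi.single b 1) ∈ forms K n (F.deg 0 b - 0) := by
  rw [sub_zero, mem_forms_natCast]
  exact F.aug_homogeneous b

theorem diff_mem (i : ℕ) (a : Fin (F.rank i)) (b : Fin (F.rank (i + 1))) :
    (LinearMap.proj a ∘ₗ F.diff i) (Pi.single b 1) ∈ forms K n (F.deg (i + 1) b - F.deg i a) := by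
  change F.diff i (Pi.single b 1) a ∈ _
  by_cases h : F.diff i (Pi.single b 1) a = 0
  · rw [h]
    exact zero_mem _
  · obtain ⟨e, he, hh⟩ := F.diff_homogeneous i b a h
    rw [← he, Nat.cast_add, add_sub_cancel_left, mem_forms_natCast]
    exact hh

/-- The graded pieces of the `i`-th syzygy module, the image of `Fᵢ₊₁ → Fᵢ`. -/
noncomputable def syzForms (i : ℕ) (d : ℤ) :
    Submodule K (Fin (F.rank i) → MvPolynomial (Fin n) K) :=
  (LinearMap.range (F.diff i)).restrictScalars K ⊓ freeForms K n (F.deg i) d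

theorem mem_syzForms_zero (d : ℤ) (v : Fin (F.rank 0) → MvPolynomial (Fin n) K) :
    v ∈ F.syzForms 0 d ↔ v ∈ freeForms K n (F.deg 0) d ∧ F.aug v = 0 := by
  rw [syzForms, F.exact_aug, and_comm]
  rfl

theorem mem_syzForms_succ (i : ℕ) (d : ℤ) (v : Fin (F.rank (i + 1)) → MvPolynomial (Fin n) K) :
    v ∈ F.syzForms (i + 1) d ↔ v ∈ freeForms K n (F.deg (i + 1)) d ∧ F.diff i v = 0 := by
  rw [syzForms, F.exact_diff, and_comm]
  rfl

theorem aug_mem_idealForms (d : ℤ) (v : Fin (F.rank 0) → MvPolynomial (Fin n) K)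
    (hv : v ∈ freeForms K n (F.deg 0) d) : F.aug v ∈ idealForms I d := by
  refine ⟨?_, ?_⟩
  · have : F.aug v ∈ LinearMap.range F.aug := ⟨v, rfl⟩
    rwa [F.range_aug] at this
  · have := linearMap_mem_forms F.aug_mem hv
    rwa [sub_zero] at this

theorem exists_aug_eq (d : ℤ) (f : MvPolynomial (Fin n) K) (hf : f ∈ idealForms I d) :
    ∃ v ∈ freeForms K n (F.deg 0) d, F.aug v = f := by
  have h : f ∈ LinearMap.range F.aug := by
    rw [F.range_aug]
    exact hf.1
  obtain ⟨v, rfl⟩ := h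
  refine ⟨_, freePart_mem (F.deg 0) d v, ?_⟩
  rw [← formPart_linearMap F.aug_mem, sub_zero]
  exact formPart_eq_self hf.2

theorem diff_mem_syzForms (i : ℕ) (d : ℤ) (v : Fin (F.rank (i + 1)) → MvPolynomial (Fin n) K)
    (hv : v ∈ freeForms K n (F.deg (i + 1)) d) : F.diff i v ∈ F.syzForms i d :=
  ⟨⟨v, rfl⟩, (mem_freeForms _).2 fun a => linearMap_mem_forms (F.diff_mem i a) hv⟩

theorem exists_diff_eq (i : ℕ) (d : ℤ) (f : Fin (F.rank i) → MvPolynomial (Fin n) K)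
    (hf : f ∈ F.syzForms i d) :
    ∃ v ∈ freeForms K n (F.deg (i + 1)) d, F.diff i v = f := by
  obtain ⟨⟨v, rfl⟩, h⟩ := hf
  refine ⟨_, freePart_mem (F.deg (i + 1)) d v, funext fun a => ?_⟩
  exact (formPart_linearMap (F.diff_mem i a) d v).symm.trans
    (formPart_eq_self ((mem_freeForms _).1 h a))

theorem koszulC_syzForms_le (i : ℕ) (j : ℤ) :
    koszulC (F.syzForms i) n 0 j ≤ koszulB (varSeq K n) (freeForms K n (F.deg i)) n 0 j :=
  koszulC_le_koszulB_freeForms _ _ (by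
    rintro _ ⟨v, rfl⟩ a
    exact F.minimal i v a) j

theorem koszulH_idealForms_succ (p : ℕ) (j : ℤ) :
    koszulH (varSeq K n) (idealForms I) n (p + 1) j =
      koszulH (varSeq K n) (F.syzForms 0) n p j :=
  koszulH_succ_eq_of_ker (varSeq_smul_mem_freeForms _) F.mem_syzForms_zero F.aug_mem_idealForms
    F.exists_aug_eq (koszulZ_le_koszulB_freeForms _) (F.koszulC_syzForms_le 0) p j

theorem koszulH_syzForms_succ (i p : ℕ) (j : ℤ) :
    koszulH (varSeq K n) (F.syzForms i) n (p + 1) j =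
      koszulH (varSeq K n) (F.syzForms (i + 1)) n p j :=
  koszulH_succ_eq_of_ker (varSeq_smul_mem_freeForms _) (F.mem_syzForms_succ i)
    (F.diff_mem_syzForms i) (F.exists_diff_eq i) (koszulZ_le_koszulB_freeForms _)
    (F.koszulC_syzForms_le (i + 1)) p j

theorem koszulH_idealForms_eq_koszulH_syzForms (i p : ℕ) (j : ℤ) :
    koszulH (varSeq K n) (idealForms I) n (p + 1 + i) j =
      koszulH (varSeq K n) (F.syzForms i) n p j := by
  induction i generalizing p with
  | zero => exact F.koszulH_idealForms_succ p j
  | succ i ih =>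
    rw [← F.koszulH_syzForms_succ, ← ih, show p + 1 + (i + 1) = p + 1 + 1 + i by ring]

/-- The graded Betti numbers are the dimensions of the graded pieces of Koszul homology. -/
theorem betti_eq_koszulH (i : ℕ) (j : ℤ) :
    F.betti i j = koszulH (varSeq K n) (idealForms I) n i j := by
  rw [betti, ← koszulH_freeForms_zero (K := K) (n := n) (F.deg i) j]
  cases i with
  | zero =>
    exact (koszulH_zero_eq_of_ker (varSeq_smul_mem_freeForms _) F.mem_syzForms_zero
      F.aug_mem_idealForms F.exists_aug_eq (F.koszulC_syzForms_le 0) j).symm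
  | succ i =>
    rw [show i + 1 = 0 + 1 + i by ring, F.koszulH_idealForms_eq_koszulH_syzForms,
      show 0 + 1 + i = i + 1 by ring]
    exact (koszulH_zero_eq_of_ker (varSeq_smul_mem_freeForms _) (F.mem_syzForms_succ i)
      (F.diff_mem_syzForms i) (F.exists_diff_eq i) (F.koszulC_syzForms_le (i + 1)) j).symm

end MinimalGradedFreeResolution

theorem gradedBetti_eq_koszulH {I : Ideal (MvPolynomial (Fin n) K)}
    (h : Nonempty (MinimalGradedFreeResolution I)) (i : ℕ) (j : ℤ) :
    gradedBetti I i j = koszulH (varSeq K n) (idealForms I) n i j := by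
  rw [gradedBetti, dif_pos h, MinimalGradedFreeResolution.betti_eq_koszulH]

end Betti
end BoijSoederberg

namespace BoijSoederberg

open MvPolynomial Filter
open scoped Pointwise

section Powers

variable {K : Type*} [Field K] {n r : ℕ} {G : Set (MvPolynomial (Fin n) K)}

theorem pow_mem_forms (hG : ∀ g ∈ G, g ∈ forms K n r) (k : ℕ) :
    ∀ g ∈ G ^ k, g ∈ forms K n (r * k : ℤ) := by
  induction k with
  | zero =>
    intro g hg
    rw [pow_zero, Set.mem_one] at hg
    subst hg
    rw [Nat.cast_zero, mul_zero]
    exact isWeightedHomogeneous_one K _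
  | succ k ih =>
    intro g hg
    rw [pow_succ] at hg
    obtain ⟨a, ha, b, hb, rfl⟩ := hg
    have := mul_mem_forms (ih a ha) (hG b hb)
    rwa [show (r * k + r : ℤ) = r * (k + 1 : ℕ) by push_cast; ring] at this

/-- The graded pieces of a power of an equigenerated ideal. -/
theorem idealForms_pow_le_span (hG : ∀ g ∈ G, g ∈ forms K n r) (k : ℕ) (d : ℤ) :
    idealForms (Ideal.span G ^ k) d ≤ Submodule.span K
      {f | ∃ u : Fin n →₀ ℕ, ∃ g ∈ G ^ k, (u.degree + r * k : ℤ) = d ∧ f = monomial u 1 * g} := by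
  rintro f ⟨hf, hfd⟩
  rw [Ideal.span, Submodule.span_pow,
    ← Submodule.span_smul_of_span_eq_top (s := Set.range fun u : Fin n →₀ ℕ => monomial u (1 : K))
      (by simpa using (basisMonomials (Fin n) K).span_eq)] at hf
  have h := Submodule.mem_map_of_mem (f := formPart K n d) hf
  rw [formPart_eq_self hfd, Submodule.map_span] at h
  refine Submodule.span_le.2 ?_ h
  rintro _ ⟨_, ⟨_, ⟨u, rfl⟩, g, hg, rfl⟩, rfl⟩
  have hmem := mul_mem_forms (monomial_mem_forms u (1 : K)) (pow_mem_forms hG k g hg)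
  simp only [smul_eq_mul]
  by_cases hd : (u.degree + r * k : ℤ) = d
  · subst hd
    rw [formPart_eq_self hmem]
    exact Submodule.subset_span ⟨u, g, hg, rfl, rfl⟩
  · rw [formPart_eq_zero hmem (Ne.symm hd)]
    exact zero_mem _

variable (G) in
/-- The map from the polynomial ring in the variables and the generators of an ideal. -/
noncomputable def genMap : MvPolynomial (Fin n ⊕ G) K →ₐ[K] MvPolynomial (Fin n) K :=
  aeval (Sum.elim X Subtype.val)

variable (G) in
/-- The bidegrees of the variables and of the generators. -/
def genWeight : Fin n ⊕ G → ℕ × ℕ :=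
  Sum.elim (fun _ => (1, 0)) (fun _ => (0, 1))

theorem weight_genWeight_inl (u : Fin n →₀ ℕ) :
    Finsupp.weight (genWeight G) (u.mapDomain Sum.inl) = (u.degree, 0) := by
  induction u using Finsupp.induction_linear with
  | zero => rw [Finsupp.mapDomain_zero, map_zero, map_zero]; rfl
  | add u v hu hv => rw [Finsupp.mapDomain_add, map_add, hu, hv, map_add, Prod.mk_add_mk, add_zero]
  | single i m => simp [Finsupp.weight_apply, genWeight, Prod.ext_iff]

theorem exists_genMap_eq (k : ℕ) : ∀ g ∈ G ^ k,
    ∃ τ, IsWeightedHomogeneous (genWeight G) τ (0, k) ∧ genMap G τ = g := by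
  induction k with
  | zero =>
    intro g hg
    rw [pow_zero, Set.mem_one] at hg
    subst hg
    exact ⟨1, isWeightedHomogeneous_one _ _, map_one _⟩
  | succ k ih =>
    intro g hg
    rw [pow_succ] at hg
    obtain ⟨a, ha, b, hb, rfl⟩ := hg
    obtain ⟨τ, hτ, rfl⟩ := ih a ha
    have h := hτ.mul (isWeightedHomogeneous_X K (genWeight G) (Sum.inr ⟨b, hb⟩))
    refine ⟨τ * X (Sum.inr ⟨b, hb⟩), ?_, ?_⟩
    · rwa [show ((0, k) + genWeight G (Sum.inr ⟨b, hb⟩) : ℕ × ℕ) = (0, k + 1) from rfl] at h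
    · rw [map_mul, show genMap G (X (Sum.inr ⟨b, hb⟩)) = b from aeval_X _ _]

theorem idealForms_pow_le_map (hG : ∀ g ∈ G, g ∈ forms K n r) (j k : ℕ) :
    idealForms (Ideal.span G ^ k) (r * k + j) ≤
      (weightedHomogeneousSubmodule K (genWeight G) (j, k)).map (genMap G).toLinearMap := by
  refine (idealForms_pow_le_span hG k _).trans (Submodule.span_le.2 ?_)
  rintro _ ⟨u, g, hg, hd, rfl⟩
  obtain rfl : u.degree = j := by omega
  obtain ⟨τ, hτ, rfl⟩ := exists_genMap_eq k g hg
  refine ⟨rename Sum.inl (monomial u 1) * τ, ?_, ?_⟩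
  · have h : IsWeightedHomogeneous (genWeight G) (rename Sum.inl (monomial u (1 : K)))
        (u.degree, 0) := by
      rw [rename_monomial]
      apply isWeightedHomogeneous_monomial
      exact weight_genWeight_inl u
    simpa using h.mul hτ
  · have h : genMap G (rename Sum.inl (monomial u (1 : K))) = monomial u 1 := by
      rw [genMap, aeval_rename]
      exact aeval_X_left_apply _
    change genMap G _ = _
    rw [map_mul, h]

theorem varSeq_smul_mem_idealForms (I : Ideal (MvPolynomial (Fin n) K)) (i : ℕ) (d : ℤ)
    (f : MvPolynomial (Fin n) K) (hf : f ∈ idealForms I d) :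
    varSeq K n i • f ∈ idealForms I (d + 1) := by
  refine ⟨I.mul_mem_left _ hf.1, ?_⟩
  rw [add_comm]
  exact mul_mem_forms (varSeq_mem_forms i) hf.2

theorem mul_mem_idealForms_pow (hG : ∀ g ∈ G, g ∈ forms K n r) {g : MvPolynomial (Fin n) K}
    (hg : g ∈ G) {k : ℕ} {d : ℤ} {f : MvPolynomial (Fin n) K}
    (hf : f ∈ idealForms (Ideal.span G ^ k) d) :
    g * f ∈ idealForms (Ideal.span G ^ (k + 1)) (d + r) := by
  constructor
  · rw [pow_succ']
    exact Ideal.mul_mem_mul (Ideal.subset_span hg) hf.1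
  · rw [add_comm]
    exact mul_mem_forms (hG g hg) hf.2

variable (G r) in
/-- The Koszul cycles of the powers of an equigenerated ideal, in bidegree `(row, power)`. -/
noncomputable def powZ (p : ℕ) (d : ℕ × ℕ) :
    Submodule K (KoszulIndex n → MvPolynomial (Fin n) K) :=
  koszulZ (varSeq K n) (idealForms (Ideal.span G ^ d.2)) n p (r * d.2 + d.1 + p)

variable (G r) in
/-- The Koszul boundaries of the powers of an equigenerated ideal, in bidegree `(row, power)`. -/
noncomputable def powB (p : ℕ) (d : ℕ × ℕ) :
    Submodule K (KoszulIndex n → MvPolynomial (Fin n) K) :=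
  koszulB (varSeq K n) (idealForms (Ideal.span G ^ d.2)) n p (r * d.2 + d.1 + p)

theorem powB_le_powZ (p : ℕ) (d : ℕ × ℕ) : powB r G p d ≤ powZ r G p d :=
  koszulB_le_koszulZ (varSeq_smul_mem_idealForms _) _ _ _

theorem powZ_apply_mem (hG : ∀ g ∈ G, g ∈ forms K n r) (p : ℕ) (d : ℕ × ℕ) :
    ∀ c ∈ powZ r G p d, ∀ b, c b ∈
      (weightedHomogeneousSubmodule K (genWeight G) d).map (genMap G).toLinearMap := by
  intro c hc b
  have h := koszulC_apply_mem hc.1 b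
  rw [show (r * d.2 + d.1 + p - p : ℤ) = r * d.2 + d.1 by ring] at h
  exact idealForms_pow_le_map hG d.1 d.2 h

theorem smul_mem_koszulC (hG : ∀ g ∈ G, g ∈ forms K n r) {g : MvPolynomial (Fin n) K}
    (hg : g ∈ G) {t p k : ℕ} {j : ℤ} {c : KoszulIndex t → MvPolynomial (Fin n) K}
    (hc : c ∈ koszulC (idealForms (Ideal.span G ^ k)) t p j) :
    g • c ∈ koszulC (idealForms (Ideal.span G ^ (k + 1))) t p (j + r) := by
  refine fun b => ⟨fun hb => ?_, fun hb => ?_⟩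
  · have := mul_mem_idealForms_pow hG hg ((hc b).1 hb)
    rwa [show j - p + r = j + r - p by ring] at this
  · rw [Pi.smul_apply, (hc b).2 hb, smul_zero]

theorem gen_smul_mem_powZ (hG : ∀ g ∈ G, g ∈ forms K n r) {g : MvPolynomial (Fin n) K}
    (hg : g ∈ G) {p j k : ℕ} {c : KoszulIndex n → MvPolynomial (Fin n) K}
    (hc : c ∈ powZ r G p (j, k)) : g • c ∈ powZ r G p (j, k + 1) := by
  have h := smul_mem_koszulC hG hg hc.1
  rw [show (r * k + j + p + r : ℤ) = r * (k + 1 : ℕ) + j + p by push_cast; ring] at h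
  refine ⟨h, ?_⟩
  have h' : koszulD (varSeq K n) n c = 0 := hc.2
  change koszulD (varSeq K n) n (g • c) = 0
  rw [map_smul, h', smul_zero]

theorem gen_smul_mem_powB (hG : ∀ g ∈ G, g ∈ forms K n r) {g : MvPolynomial (Fin n) K}
    (hg : g ∈ G) {p j k : ℕ} {c : KoszulIndex n → MvPolynomial (Fin n) K}
    (hc : c ∈ powB r G p (j, k)) : g • c ∈ powB r G p (j, k + 1) := by
  obtain ⟨c', hc', rfl⟩ := hc
  have h := smul_mem_koszulC hG hg hc'
  rw [show (r * k + j + p + r : ℤ) = r * (k + 1 : ℕ) + j + p by push_cast; ring] at h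
  exact ⟨_, h, (koszulD (varSeq K n) n).map_smul g c'⟩

theorem var_smul_mem_powB {p j k : ℕ} (i : Fin n) {c : KoszulIndex n → MvPolynomial (Fin n) K}
    (hc : c ∈ powZ r G p (j, k)) : (X i : MvPolynomial (Fin n) K) • c ∈ powB r G p (j + 1, k) := by
  have h := koszulD_wedge_add (varSeq K n) i.2 c
  have h' : koszulD (varSeq K n) n c = 0 := hc.2
  rw [h', map_zero, add_zero, varSeq, dif_pos i.2] at h
  have hw := koszulWedge_mem (R := MvPolynomial (Fin n) K) (i : ℕ) hc.1
  rw [show (r * k + j + p + 1 : ℤ) = r * k + (j + 1 : ℕ) + p by push_cast; ring] at hw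
  exact ⟨_, hw, h⟩

theorem genMap_X_smul_mem_powZ (hG : ∀ g ∈ G, g ∈ forms K n r) (p : ℕ) (s : Fin n ⊕ G)
    (d : ℕ × ℕ) (c : KoszulIndex n → MvPolynomial (Fin n) K) (hc : c ∈ powZ r G p d) :
    genMap G (X s) • c ∈ powZ r G p (d + genWeight G s) := by
  rcases s with i | g
  · rw [show genMap G (X (Sum.inl i)) = X i from aeval_X _ _]
    exact powB_le_powZ _ _ (var_smul_mem_powB i hc)
  · rw [show genMap G (X (Sum.inr g)) = g from aeval_X _ _]
    exact gen_smul_mem_powZ hG g.2 hc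

/-- In all rows below a fixed one, the Koszul homology of the powers vanishes. -/
theorem exists_powZ_le_powB [Finite G] (hG : ∀ g ∈ G, g ∈ forms K n r) (p : ℕ) :
    ∃ N : ℕ, ∀ j k : ℕ, N < j → powZ r G p (j, k) ≤ powB r G p (j, k) := by
  obtain ⟨F, hF, h⟩ := exists_finite_generating_degrees (genWeight G) (genMap G) (powZ r G p)
    (powZ_apply_mem hG p) (genMap_X_smul_mem_powZ hG p)
  obtain ⟨N, hN⟩ := (hF.image Prod.fst).bddAbove
  refine ⟨N, fun j k hj => ?_⟩
  induction k using Nat.strong_induction_on with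
  | _ k ih =>
  intro c hc
  have hc' := h (j, k) (fun hF => absurd (hN ⟨_, hF, rfl⟩) (not_le.2 hj)) c hc
  refine Submodule.span_le.2 ?_ hc'
  rintro _ ⟨i | g, ⟨j', k'⟩, hd, v, hv, rfl⟩
  · obtain ⟨rfl, rfl⟩ : j' + 1 = j ∧ k' = k := Prod.ext_iff.1 hd
    rw [show genMap G (X (Sum.inl i)) = X i from aeval_X _ _]
    exact var_smul_mem_powB i hv
  · obtain ⟨rfl, rfl⟩ : j' = j ∧ k' + 1 = k := Prod.ext_iff.1 hd
    rw [show genMap G (X (Sum.inr g)) = g from aeval_X _ _]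
    exact gen_smul_mem_powB hG g.2 (ih k' (Nat.lt_succ_self k') hv)

theorem finiteDimensional_forms (d : ℕ) : FiniteDimensional K (forms K n d) := by
  have h : forms K n d = homogeneousSubmodule (Fin n) K d := by
    ext f
    rw [mem_forms_natCast, mem_homogeneousSubmodule]
  rw [h]
  exact Module.Finite.iff_fg.2 (weightedHomogeneousSubmodule_fg _ _ (fun _ => one_ne_zero) d)

theorem finiteDimensional_powZ (p : ℕ) (d : ℕ × ℕ) : FiniteDimensional K (powZ r G p d) := by
  have h : powZ r G p d ≤ Submodule.pi Set.univ fun _ => forms K n (r * d.2 + d.1 : ℕ) := by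
    intro c hc
    rw [Submodule.mem_pi]
    intro b _
    have h := (koszulC_apply_mem hc.1 b).2
    rwa [show (r * d.2 + d.1 + p - p : ℤ) = (r * d.2 + d.1 : ℕ) by push_cast; ring] at h
  have hfin : FiniteDimensional K ↥(Submodule.pi (Set.univ : Set (KoszulIndex n))
      fun _ => forms K n (r * d.2 + d.1 : ℕ)) :=
    Module.Finite.iff_fg.2 (Submodule.fg_pi fun _ =>
      Module.Finite.iff_fg.1 (finiteDimensional_forms _))
  exact Submodule.finiteDimensional_of_le h

/-- The dimensions of the Koszul homology of the powers in a fixed row. -/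
theorem eventuallyPolynomial_powZ_sub_powB [Finite G] (hG : ∀ g ∈ G, g ∈ forms K n r)
    (p j : ℕ) : EventuallyPolynomial fun k =>
      (Module.finrank K (powZ r G p (j, k)) : ℚ) - Module.finrank K (powB r G p (j, k)) := by
  classical
  have := Fintype.ofFinite G
  let Y : G → (KoszulIndex n → MvPolynomial (Fin n) K) →ₗ[K]
      (KoszulIndex n → MvPolynomial (Fin n) K) := fun g =>
    (LinearMap.lsmul (MvPolynomial (Fin n) K) _ (g : MvPolynomial (Fin n) K)).restrictScalars K
  have hY : ∀ g c, Y g c = (g : MvPolynomial (Fin n) K) • c := fun _ _ => rfl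
  refine IsNoetherianPair.eventuallyPolynomial Y (fun g g' c => ?_) Finset.univ
    (fun k => powB r G p (j, k)) (fun k => powZ r G p (j, k)) (fun k => powB_le_powZ _ _)
    (fun k => finiteDimensional_powZ _ _) (fun g _ k c hc => gen_smul_mem_powB hG g.2 hc)
    (fun g _ k c hc => gen_smul_mem_powZ hG g.2 hc) ?_
  · rw [hY, hY, hY, hY, smul_smul, smul_smul, mul_comm]
  · intro W _ hWV hW
    let W' : ℕ × ℕ → Submodule K (KoszulIndex n → MvPolynomial (Fin n) K) := fun d =>
      if d.1 < j then ⊥ else if d.1 = j then W d.2 else powZ r G p d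
    have hW'lt : ∀ d, d.1 < j → W' d = ⊥ := fun d hd => if_pos hd
    have hW'eq : ∀ k, W' (j, k) = W k := fun k => by simp [W']
    have hW'gt : ∀ d, j < d.1 → W' d = powZ r G p d := fun d hd => by
      simp [W', hd.not_gt, hd.ne']
    have hW'le : ∀ d, W' d ≤ powZ r G p d := by
      rintro ⟨j', k⟩
      rcases lt_trichotomy j' j with h | rfl | h
      · rw [hW'lt _ h]
        exact bot_le
      · rw [hW'eq]
        exact hWV k
      · rw [hW'gt _ h]
    obtain ⟨F, hF, h⟩ := exists_finite_generating_degrees (genWeight G) (genMap G) W'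
      (fun d c hc => powZ_apply_mem hG p d c (hW'le d hc)) (by
        rintro s ⟨j', k⟩ c hc
        have hZ := genMap_X_smul_mem_powZ hG p s _ c (hW'le _ hc)
        rcases lt_trichotomy j' j with h | rfl | h
        · rw [hW'lt _ h, Submodule.mem_bot] at hc
          rw [hc, smul_zero]
          exact zero_mem _
        · rcases s with i | g
          · rw [hW'gt _ (show j' < j' + 1 from Nat.lt_succ_self _)]
            exact hZ
          · rw [hW'eq] at hc
            change _ ∈ W' (j', k + 1)
            rw [hW'eq, show genMap G (X (Sum.inr g)) = g from aeval_X _ _]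
            exact hW g (Finset.mem_univ g) k c hc
        · rw [hW'gt _ (show j < j' + (genWeight G s).1 from Nat.lt_add_right _ h)]
          exact hZ)
    obtain ⟨N, hN⟩ := (hF.image Prod.snd).bddAbove
    filter_upwards [eventually_ge_atTop N] with k hk
    refine le_trans ?_ le_sup_right
    intro c hc
    rw [← hW'eq] at hc
    have hc' := h (j, k + 1) (fun hF => by
      have : k + 1 ≤ N := hN ⟨_, hF, rfl⟩
      omega) c hc
    refine Submodule.span_le.2 ?_ hc'
    rintro _ ⟨i | g, ⟨j', k'⟩, hd, v, hv, rfl⟩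
    · obtain ⟨rfl, rfl⟩ : j' + 1 = j ∧ k' = k + 1 := Prod.ext_iff.1 hd
      rw [hW'lt _ (show j' < j' + 1 from Nat.lt_succ_self _), Submodule.mem_bot] at hv
      rw [hv, smul_zero]
      exact zero_mem _
    · obtain ⟨rfl, h2⟩ : j' = j ∧ k' + 1 = k + 1 := Prod.ext_iff.1 hd
      obtain rfl : k' = k := Nat.succ_injective h2
      rw [hW'eq] at hv
      rw [show genMap G (X (Sum.inr g)) = g from aeval_X _ _]
      exact Submodule.mem_iSup_of_mem g (Submodule.mem_iSup_of_mem (Finset.mem_univ g)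
        ⟨v, hv, rfl⟩)

theorem koszulH_eq_zero {I : Ideal (MvPolynomial (Fin n) K)} {p : ℕ} {j : ℤ}
    (h : koszulZ (varSeq K n) (idealForms I) n p j ≤ koszulB (varSeq K n) (idealForms I) n p j) :
    koszulH (varSeq K n) (idealForms I) n p j = 0 := by
  rw [koszulH, Submodule.submoduleOf_eq_top.2 h]
  exact Module.finrank_zero_of_subsingleton

theorem koszulH_pow_eq_sub (p j k : ℕ) :
    (koszulH (varSeq K n) (idealForms (Ideal.span G ^ k)) n p (r * k + j + p) : ℚ) =
      Module.finrank K (powZ r G p (j, k)) - Module.finrank K (powB r G p (j, k)) := by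
  have hfin := finiteDimensional_powZ (r := r) (G := G) p (j, k)
  have h := ((powB r G p (j, k)).submoduleOf (powZ r G p (j, k))).finrank_quotient_add_finrank
  rw [LinearEquiv.finrank_eq (Submodule.submoduleOfEquivOfLe (powB_le_powZ _ _))] at h
  rw [← h, Nat.cast_add, add_sub_cancel_right]
  rfl

end Powers

section Equigenerated

variable {K : Type*} [Field K] {n r : ℕ} {I : Ideal (MvPolynomial (Fin n) K)}

theorem IsEquigenerated.exists_finite (hI : IsEquigenerated I r) :
    ∃ G : Set (MvPolynomial (Fin n) K), G.Finite ∧ (∀ g ∈ G, g ∈ forms K n r) ∧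
      I = Ideal.span G := by
  obtain ⟨G, hG, rfl⟩ := hI
  obtain ⟨G', hG', h⟩ := (Submodule.fg_span_iff_fg_span_finset_subset G).1
    (IsNoetherian.noetherian (Ideal.span G))
  exact ⟨G', G'.finite_toSet, fun g hg => mem_forms_natCast.2 (hG g (hG' hg)), h⟩

theorem bettiDiagram_pow_apply (hI : IsEquigenerated I r) (k p : ℕ) (j : ℤ) :
    bettiDiagram (I ^ k) p j = koszulH (varSeq K n) (idealForms (I ^ k)) n p j := by
  rw [bettiDiagram, gradedBetti_eq_koszulH (hI.nonempty_resolution_pow k)]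

/-- The regularity of the powers of an equigenerated ideal grows linearly. -/
theorem IsEquigenerated.exists_bettiWindow (hI : IsEquigenerated I r) :
    ∃ N : ℕ, ∀ k : ℕ, bettiDiagram (I ^ k) ∈ bettiWindow n (r * k) (r * k + N) := by
  obtain ⟨G, hGfin, hG, rfl⟩ := hI.exists_finite
  have := hGfin.to_subtype
  choose N hN using exists_powZ_le_powB hG
  refine ⟨∑ p ∈ Finset.range (n + 1), N p, fun k p j => ?_⟩
  rw [bettiDiagram_pow_apply hI]
  contrapose!
  intro h
  rw [Nat.cast_eq_zero]
  apply koszulH_eq_zero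
  by_cases hp : p ≤ n
  · rintro c hc
    by_cases hj : (r * k : ℤ) ≤ j - p
    · have hj' := h hp hj
      obtain ⟨q, hq⟩ : ∃ q : ℕ, (r * k + q + p : ℤ) = j :=
        ⟨(j - p - r * k).toNat, by rw [Int.toNat_of_nonneg (by omega)]; ring⟩
      subst hq
      refine hN p q k ?_ hc
      have h1 := Finset.single_le_sum (f := N) (fun _ _ => Nat.zero_le _)
        (Finset.mem_range.2 (Nat.lt_succ_of_le hp))
      zify at h1 ⊢
      push_cast at hj'
      linarith
    · have hc0 : c = 0 := by
        funext b
        have := idealForms_pow_le_span hG k _ (koszulC_apply_mem hc.1 b)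
        rw [Submodule.span_eq_bot.2, Submodule.mem_bot] at this
        · exact this
        · rintro _ ⟨u, g, -, hd, -⟩
          omega
      rw [hc0]
      exact zero_mem _
  · intro c hc
    have hc0 : c = 0 := funext fun b => (hc.1 b).2 fun hb => hp (hb ▸ b.card_le)
    rw [hc0]
    exact zero_mem _

/-- The Betti numbers of the powers of an equigenerated ideal in a fixed position, relative to the
first row, are eventually polynomial. -/
theorem IsEquigenerated.eventuallyPolynomial_bettiDiagram (hI : IsEquigenerated I r) (p j : ℕ) :
    EventuallyPolynomial fun k => bettiDiagram (I ^ k) p (r * k + j + p) := by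
  obtain ⟨G, hGfin, hG, rfl⟩ := hI.exists_finite
  have := hGfin.to_subtype
  simp only [bettiDiagram_pow_apply hI, koszulH_pow_eq_sub]
  exact eventuallyPolynomial_powZ_sub_powB hG p j

end Equigenerated
end BoijSoederberg

namespace BoijSoederberg

section Chains

/-- The row in which the pure diagram of `d` has its entry in column `p`, and `T` if this column
is zero. -/
def DegreeSequence.row (d : DegreeSequence) (T : ℤ) (p : ℕ) : ℤ :=
  if h : p < d.len + 1 then d.deg ⟨p, h⟩ - p else T

theorem pureDiagram_ne_zero_iff {d : DegreeSequence} {p : ℕ} {j : ℤ} :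
    pureDiagram d p j ≠ 0 ↔ ∃ h : p < d.len + 1, j = d.deg ⟨p, h⟩ := by
  rw [pureDiagram]
  constructor
  · intro h
    split_ifs at h with h1 h2
    · exact ⟨h1, h2⟩
    · exact absurd rfl h
    · exact absurd rfl h
  · rintro ⟨h, rfl⟩
    rw [dif_pos h, if_pos rfl, Finset.prod_ne_zero_iff]
    intro k hk
    refine one_div_ne_zero ?_
    rw [Int.cast_ne_zero, abs_ne_zero, sub_ne_zero]
    exact fun h' => Finset.ne_of_mem_erase hk (d.strictMono.injective h')

theorem pureDiagram_translate (d : DegreeSequence) (t : ℤ) (p : ℕ) (j : ℤ) :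
    pureDiagram (d.translate t) p j = pureDiagram d p (j - t) := by
  simp only [pureDiagram, DegreeSequence.translate, sub_eq_iff_eq_add, add_sub_add_right_eq_sub]
  rfl

theorem pureDiagram_mem_bettiWindow_iff {n : ℕ} {M M' : ℤ} {d : DegreeSequence} :
    pureDiagram d ∈ bettiWindow n M M' ↔
      d.len ≤ n ∧ ∀ i : Fin (d.len + 1), M ≤ d.deg i - i ∧ d.deg i - i ≤ M' := by
  constructor
  · intro h
    have h' : ∀ i : Fin (d.len + 1), (i : ℕ) ≤ n ∧ M ≤ d.deg i - i ∧ d.deg i - i ≤ M' :=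
      fun i => h i (d.deg i) (pureDiagram_ne_zero_iff.2 ⟨i.2, rfl⟩)
    exact ⟨(h' (Fin.last _)).1, fun i => (h' i).2⟩
  · rintro ⟨h1, h2⟩ p j hj
    obtain ⟨h, rfl⟩ := pureDiagram_ne_zero_iff.1 hj
    exact ⟨(Nat.le_of_lt_succ h).trans h1, h2 ⟨p, h⟩⟩

theorem pureDiagram_ne_zero_iff_row {d : DegreeSequence} {T v : ℤ} (hv : v < T) (p : ℕ) :
    pureDiagram d p (v + p) ≠ 0 ↔ d.row T p = v := by
  rw [pureDiagram_ne_zero_iff, DegreeSequence.row]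
  by_cases h : p < d.len + 1
  · rw [dif_pos h, sub_eq_iff_eq_add]
    exact ⟨fun ⟨_, h'⟩ => h'.symm, fun h' => ⟨h, h'.symm⟩⟩
  · rw [dif_neg h]
    exact ⟨fun ⟨h', _⟩ => absurd h' h, fun h' => absurd h' hv.ne'⟩

variable {n : ℕ} {M M' : ℤ}

theorem row_le {d : DegreeSequence} (hd : pureDiagram d ∈ bettiWindow n M M') (p : ℕ) :
    d.row (M' + 1) p ≤ M' + 1 := by
  rw [DegreeSequence.row]
  split_ifs with h
  · exact (((pureDiagram_mem_bettiWindow_iff.1 hd).2 ⟨p, h⟩).2).trans (by omega)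
  · exact le_rfl

theorem row_le_iff {d : DegreeSequence} (hd : pureDiagram d ∈ bettiWindow n M M') (p : ℕ) :
    d.row (M' + 1) p ≤ M' ↔ p < d.len + 1 := by
  rw [DegreeSequence.row]
  split_ifs with h
  · exact iff_of_true ((pureDiagram_mem_bettiWindow_iff.1 hd).2 ⟨p, h⟩).2 h
  · exact iff_of_false (by omega) h

theorem le_row {d : DegreeSequence} (hd : pureDiagram d ∈ bettiWindow n M M') (hM : M ≤ M' + 1)
    (p : ℕ) : M ≤ d.row (M' + 1) p := by
  rw [DegreeSequence.row]
  split_ifs with h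
  · exact ((pureDiagram_mem_bettiWindow_iff.1 hd).2 ⟨p, h⟩).1
  · exact hM

theorem row_of_lt {d : DegreeSequence} (hd : pureDiagram d ∈ bettiWindow n M M') {p : ℕ}
    (hp : n < p) : d.row (M' + 1) p = M' + 1 := by
  have := (pureDiagram_mem_bettiWindow_iff.1 hd).1
  rw [DegreeSequence.row, dif_neg (by omega)]

theorem row_monotone {d : DegreeSequence} (hd : pureDiagram d ∈ bettiWindow n M M') :
    Monotone (d.row (M' + 1)) := by
  refine monotone_nat_of_le_succ fun p => ?_
  by_cases h : p + 1 < d.len + 1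
  · have h1 : d.deg ⟨p, by omega⟩ < d.deg ⟨p + 1, h⟩ := d.strictMono (Nat.lt_succ_self p)
    rw [DegreeSequence.row, DegreeSequence.row, dif_pos h, dif_pos (by omega)]
    push_cast
    omega
  · exact (row_le hd p).trans_eq (by rw [DegreeSequence.row, dif_neg h])

theorem le_iff_row_le {d d' : DegreeSequence} (hd : pureDiagram d ∈ bettiWindow n M M')
    (hd' : pureDiagram d' ∈ bettiWindow n M M') :
    d ≤ d' ↔ ∀ p, d.row (M' + 1) p ≤ d'.row (M' + 1) p := by
  constructor
  · rintro ⟨h, h'⟩ p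
    by_cases hp : p < d'.len + 1
    · rw [DegreeSequence.row, DegreeSequence.row, dif_pos hp, dif_pos (by omega)]
      exact sub_le_sub_right (h' ⟨p, hp⟩) _
    · exact (row_le hd p).trans_eq (by rw [DegreeSequence.row, dif_neg hp])
  · intro h
    have hlt : ∀ p, p < d'.len + 1 → p < d.len + 1 := fun p hp =>
      (row_le_iff hd p).1 ((h p).trans ((row_le_iff hd' p).2 hp))
    have hlen : d'.len ≤ d.len := Nat.le_of_lt_succ (hlt _ (Nat.lt_succ_self _))
    refine ⟨hlen, fun i => ?_⟩
    have := h i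
    rw [DegreeSequence.row, DegreeSequence.row, dif_pos i.2, dif_pos (hlt i i.2)] at this
    exact (sub_le_sub_iff_right _).1 this

theorem exists_degreeSequence_row_eq {ρ : ℕ → ℤ} (hmono : Monotone ρ) (h0 : ρ 0 ≤ M')
    (hM : ∀ p, M ≤ ρ p) (hT : ∀ p, ρ p ≤ M' + 1) (hn : ∀ p, n < p → ρ p = M' + 1) :
    ∃ d : DegreeSequence, pureDiagram d ∈ bettiWindow n M M' ∧ ∀ p, d.row (M' + 1) p = ρ p := by
  classical
  let len := Nat.findGreatest (fun p => ρ p ≤ M') n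
  have hlen : ∀ p, p < len + 1 ↔ ρ p ≤ M' := by
    intro p
    constructor
    · intro h
      exact (hmono (Nat.le_of_lt_succ h)).trans
        (Nat.findGreatest_spec (P := fun p => ρ p ≤ M') (Nat.zero_le n) h0)
    · intro h
      refine Nat.lt_succ_of_le (Nat.le_findGreatest ?_ h)
      by_contra hp
      have := hn p (not_le.1 hp)
      omega
  refine ⟨⟨len, fun i => ρ i + i, fun i i' h => ?_⟩, ?_, fun p => ?_⟩
  · have h1 := hmono (le_of_lt (show (i : ℕ) < i' from h))
    have h2 : (i : ℕ) < i' := h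
    dsimp only
    omega
  · refine pureDiagram_mem_bettiWindow_iff.2 ⟨Nat.findGreatest_le n, fun i => ?_⟩
    dsimp only
    rw [add_sub_cancel_right]
    exact ⟨hM _, (hlen i).1 i.2⟩
  · rw [DegreeSequence.row]
    split_ifs with h
    · exact add_sub_cancel_right _ _
    · have h1 := hT p
      have h2 : ¬ ρ p ≤ M' := fun h' => h ((hlen p).2 h')
      omega

variable {N l : ℕ} {d : Fin (l + 1) → DegreeSequence}

/-- The entries of a diagram in the window, as a vector. -/
def windowVector (n : ℕ) (M : ℤ) (N : ℕ) : Diagram →ₗ[ℚ] (Fin (n + 1) × Fin (N + 1) → ℚ) :=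
  LinearMap.pi fun q => LinearMap.proj (M + (q.2 : ℕ) + (q.1 : ℕ)) ∘ₗ LinearMap.proj (q.1 : ℕ)

theorem windowVector_apply (b : Diagram) (q : Fin (n + 1) × Fin (N + 1)) :
    windowVector n M N b q = b q.1 (M + (q.2 : ℕ) + (q.1 : ℕ)) := rfl

theorem eq_of_windowVector_eq {b b' : Diagram} (hb : b ∈ bettiWindow n M (M + N))
    (hb' : b' ∈ bettiWindow n M (M + N)) (h : windowVector n M N b = windowVector n M N b') :
    b = b' := by
  funext p j
  by_contra hne
  have hw := (sub_mem hb hb') p j (sub_ne_zero.2 hne)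
  obtain ⟨v, hv⟩ : ∃ v : ℕ, M + v + p = j :=
    ⟨(j - p - M).toNat, by rw [Int.toNat_of_nonneg (by omega)]; ring⟩
  subst hv
  exact hne (congrFun h (⟨p, by omega⟩, ⟨v, by omega⟩))

theorem exists_row_lt (h : IsMaximalChain n M M' d) (i : Fin (l + 1)) :
    ∃ p ≤ n, (d i).row (M' + 1) p ≤ M' ∧
      ∀ i', i < i' → (d i).row (M' + 1) p < (d i').row (M' + 1) p := by
  by_cases hi : ∃ i', i < i'
  · obtain ⟨i', hi'⟩ := hi
    obtain ⟨s, hs, hmin⟩ : ∃ s, i < s ∧ ∀ i', i < i' → s ≤ i' :=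
      ⟨⟨i + 1, by omega⟩, Nat.lt_succ_self _, fun i' h => Nat.succ_le_of_lt h⟩
    have h1 := not_le_of_gt (h.1 hs)
    rw [le_iff_row_le (h.2.1 s) (h.2.1 i)] at h1
    push Not at h1
    obtain ⟨p, hp⟩ := h1
    have h2 := row_le (h.2.1 s) p
    refine ⟨p, ?_, by omega, fun i' hi' => hp.trans_le ?_⟩
    · by_contra hpn
      rw [row_of_lt (h.2.1 s) (not_le.1 hpn), row_of_lt (h.2.1 i) (not_le.1 hpn)] at hp
      exact lt_irrefl _ hp
    · exact (le_iff_row_le (h.2.1 s) (h.2.1 i')).1 (h.1.monotone (hmin i' hi')) p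
  · exact ⟨0, Nat.zero_le _, (row_le_iff (h.2.1 i) 0).2 (Nat.succ_pos _),
      fun i' h' => absurd ⟨i', h'⟩ hi⟩

theorem windowVector_pureDiagram_ne_zero_iff (d : DegreeSequence)
    (q : Fin (n + 1) × Fin (N + 1)) :
    windowVector n M N (pureDiagram d) q ≠ 0 ↔
      d.row (M + N + 1) (q.1 : ℕ) = M + (q.2 : ℕ) := by
  rw [windowVector_apply]
  exact pureDiagram_ne_zero_iff_row (by omega) _

/-- The pure diagrams of a chain are linearly independent. -/
theorem IsMaximalChain.linearIndependent (h : IsMaximalChain n M (M + N) d) :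
    LinearIndependent ℚ fun i => windowVector n M N (pureDiagram (d i)) := by
  rw [Fintype.linearIndependent_iff]
  intro g hg i
  induction i using WellFoundedLT.induction with
  | _ i ih =>
  obtain ⟨p, hpn, hp, hlt⟩ := exists_row_lt h i
  have hMp := le_row (h.2.1 i) (by omega) p
  obtain ⟨v, hv⟩ : ∃ v : ℕ, M + v = (d i).row (M + N + 1) p :=
    ⟨((d i).row (M + N + 1) p - M).toNat, by rw [Int.toNat_of_nonneg (by omega)]; ring⟩
  let q : Fin (n + 1) × Fin (N + 1) := (⟨p, by omega⟩, ⟨v, by omega⟩)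
  have h1 := congrFun hg q
  rw [Finset.sum_apply, Finset.sum_eq_single i] at h1
  · have h2 : windowVector n M N (pureDiagram (d i)) q ≠ 0 :=
      (windowVector_pureDiagram_ne_zero_iff _ _).2 hv.symm
    exact (mul_eq_zero.1 h1).resolve_right h2
  · intro i' _ hne
    rcases lt_or_gt_of_ne hne with hi | hi
    · rw [ih i' hi, zero_smul, Pi.zero_apply]
    · have h2 : windowVector n M N (pureDiagram (d i')) q = 0 := by
        by_contra h3
        have h4 := (windowVector_pureDiagram_ne_zero_iff _ _).1 h3
        have h5 : (d i').row (M + N + 1) p = M + v := h4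
        have := hlt i' hi
        omega
      rw [Pi.smul_apply, h2, smul_zero]
  · exact fun h => absurd (Finset.mem_univ i) h

/-- A maximal chain contains the diagram which arises from one of its members by raising the rows
just above the row `s`, from column `P` on. -/
theorem IsMaximalChain.exists_raise (h : IsMaximalChain n M M' d) (hM : M ≤ M' + 1)
    {i : Fin (l + 1)} {P : ℕ} {s : ℤ} (hs : s ≤ M') (hP : P = 0 → s + 1 ≤ M')
    (hi : (d i).row (M' + 1) P ≤ s) (hi' : ∀ i', i < i' → s < (d i').row (M' + 1) P) :
    ∃ i', i < i' ∧ ∀ q, (d i').row (M' + 1) q =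
      if P ≤ q then max ((d i).row (M' + 1) q) (s + 1) else (d i).row (M' + 1) q := by
  have hdi := h.2.1 i
  obtain ⟨e, he, hrow⟩ := exists_degreeSequence_row_eq (n := n) (M := M) (M' := M')
    (ρ := fun q => if P ≤ q then max ((d i).row (M' + 1) q) (s + 1) else (d i).row (M' + 1) q)
    (by
      intro q q' hq
      have := row_monotone hdi hq
      dsimp only
      split_ifs <;> omega) (by
      have := (row_le_iff hdi 0).2 (Nat.succ_pos _)
      split_ifs with h0
      · have := hP (by omega)
        omega
      · exact this) (by
      intro q
      have := le_row hdi hM q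
      split_ifs <;> omega) (by
      intro q
      have := row_le hdi q
      split_ifs <;> omega) (by
      intro q hq
      have := row_of_lt hdi hq
      split_ifs <;> omega)
  have hle : d i ≤ e := by
    rw [le_iff_row_le hdi he]
    intro q
    rw [hrow]
    split_ifs <;> omega
  obtain ⟨i', rfl⟩ := h.2.2 e he fun i' => by
    rcases le_or_gt i' i with hii | hii
    · exact Or.inr ((h.1.monotone hii).trans hle)
    · left
      rw [le_iff_row_le he (h.2.1 i')]
      intro q
      have h1 := (le_iff_row_le hdi (h.2.1 i')).1 (h.1 hii).le q
      rw [hrow]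
      split_ifs with hPq
      · have h2 := hi' i' hii
        have h3 := row_monotone (h.2.1 i') hPq
        omega
      · exact h1
  refine ⟨i', ?_, hrow⟩
  by_contra hii
  have h1 := (le_iff_row_le he hdi).1 (h.1.monotone (not_lt.1 hii)) P
  rw [hrow, if_pos le_rfl] at h1
  omega

/-- A maximal chain contains the smallest diagram of the window. -/
theorem IsMaximalChain.exists_row_eq_bot (h : IsMaximalChain n M M' d) (hM : M ≤ M') :
    ∃ i, ∀ p ≤ n, (d i).row (M' + 1) p = M := by
  obtain ⟨e, he, hrow⟩ := exists_degreeSequence_row_eq (n := n) (M := M) (M' := M')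
    (ρ := fun q => if q ≤ n then M else M' + 1)
    (by intro q q' hq; dsimp only; split_ifs <;> omega) (by simpa using hM)
    (by intro q; split_ifs <;> omega) (by intro q; split_ifs <;> omega)
    (by intro q hq; rw [if_neg (by omega)])
  obtain ⟨i, rfl⟩ := h.2.2 e he fun i => by
    left
    rw [le_iff_row_le he (h.2.1 i)]
    intro q
    rw [hrow]
    split_ifs with hq
    · exact le_row (h.2.1 i) (by omega) q
    · rw [row_of_lt (h.2.1 i) (not_le.1 hq)]
  exact ⟨i, fun p hp => by rw [hrow, if_pos hp]⟩

/-- The length of a maximal chain is at least the dimension of the window. -/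
theorem IsMaximalChain.card_le (h : IsMaximalChain n M (M + N) d) :
    Fintype.card (Fin (n + 1) × Fin (N + 1)) ≤ Fintype.card (Fin (l + 1)) := by
  classical
  have hex : ∀ q : Fin (n + 1) × Fin (N + 1), ∃ i,
      (d i).row (M + N + 1) (q.1 : ℕ) ≤ M + (q.2 : ℕ) ∧
      ∀ i', i < i' → M + (q.2 : ℕ) < (d i').row (M + N + 1) (q.1 : ℕ) := by
    intro q
    obtain ⟨i₀, hi₀⟩ := h.exists_row_eq_bot (by omega)
    obtain ⟨i, hi, hmax⟩ := (Finset.univ.filter fun i =>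
      (d i).row (M + N + 1) (q.1 : ℕ) ≤ M + (q.2 : ℕ)).exists_max_image id
        ⟨i₀, Finset.mem_filter.2 ⟨Finset.mem_univ _, by
          rw [hi₀ _ (Nat.le_of_lt_succ q.1.2)]
          omega⟩⟩
    refine ⟨i, (Finset.mem_filter.1 hi).2, fun i' hi' => ?_⟩
    by_contra hle
    exact absurd (hmax i' (Finset.mem_filter.2 ⟨Finset.mem_univ _, not_lt.1 hle⟩)) (not_le.2 hi')
  choose f hf hf' using hex
  refine Fintype.card_le_of_injective f fun q q' hqq => ?_
  have key1 : ∀ q q', f q = f q' → ¬ (q.1 < q'.1) := by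
    intro q q' hqq hlt
    have hlt' : (q.1 : ℕ) < q'.1 := hlt
    obtain ⟨i', hi', hrow⟩ := h.exists_raise (by omega) (s := M + (q'.2 : ℕ)) (by omega)
      (by omega) (hf q') (hf' q')
    have h1 := hrow q.1
    rw [if_neg (by omega), ← hqq] at h1
    have h2 := hf' q i' (hqq ▸ hi')
    have h3 := hf q
    omega
  have key2 : ∀ q q', f q = f q' → q.1 = q'.1 → ¬ (q.2 < q'.2) := by
    intro q q' hqq heq hlt
    have hlt' : (q.2 : ℕ) < q'.2 := hlt
    obtain ⟨i', hi', hrow⟩ := h.exists_raise (by omega) (s := M + (q.2 : ℕ)) (by omega)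
      (by omega) (hf q) (hf' q)
    have h1 := hrow q.1
    rw [if_pos le_rfl] at h1
    have h2 := hf' q' i' (hqq ▸ hi')
    rw [← heq] at h2
    have h3 := hf q
    omega
  have h1 : q.1 = q'.1 :=
    le_antisymm (not_lt.1 (key1 q' q hqq.symm)) (not_lt.1 (key1 q q' hqq))
  exact Prod.ext h1 (le_antisymm (not_lt.1 (key2 q' q hqq.symm h1.symm))
    (not_lt.1 (key2 q q' hqq h1)))

/-- The coefficients of a vector with respect to the pure diagrams of a maximal chain are linear
functions of its entries. -/
theorem IsMaximalChain.exists_coefficients (h : IsMaximalChain n M (M + N) d) :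
    ∃ A : Fin (l + 1) → Fin (n + 1) × Fin (N + 1) → ℚ,
      ∀ (b : Fin (n + 1) × Fin (N + 1) → ℚ) (c : Fin (l + 1) → ℚ),
        b = ∑ i, c i • windowVector n M N (pureDiagram (d i)) ↔ ∀ i, c i = ∑ q, A i q * b q := by
  classical
  have hli := h.linearIndependent
  have hcard : Fintype.card (Fin (l + 1)) =
      Module.finrank ℚ (Fin (n + 1) × Fin (N + 1) → ℚ) := by
    rw [Module.finrank_pi]
    refine le_antisymm ?_ h.card_le
    have := hli.fintype_card_le_finrank
    rwa [Module.finrank_pi] at this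
  let B := basisOfLinearIndependentOfCardEqFinrank hli hcard
  have hB : ∀ i, B i = windowVector n M N (pureDiagram (d i)) := fun i => by simp [B]
  refine ⟨fun i q => B.repr (Pi.single q 1) i, fun b c => ?_⟩
  have hb : ∀ i, ∑ q, B.repr (Pi.single q 1) i * b q = B.repr b i := by
    intro i
    conv_rhs => rw [pi_eq_sum_univ' b]
    simp [map_sum, Finsupp.finsetSum_apply, mul_comm]
  simp only [hb, ← hB]
  constructor
  · rintro rfl i
    rw [B.repr_sum_self]
  · intro hc
    simp only [hc]
    exact (B.sum_repr b).symm

end Chains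
end BoijSoederberg

namespace BoijSoederberg

open Filter

/-- A translated family of pure diagrams in the windows `B_{rk, rk+N}` moves down by `r` rows in
each step. -/
theorem IsTranslatedFamily.exists_pureDiagram_eq {n r N k₁ : ℕ} {d : ℕ → DegreeSequence}
    (hd : IsTranslatedFamily d)
    (hw : ∀ k : ℕ, k₁ < k → pureDiagram (d k) ∈ bettiWindow n (r * k) (r * k + N)) :
    ∃ b : Diagram, ∀ (k p : ℕ) (j : ℤ), pureDiagram (d k) p (r * k + j) = b p j := by
  obtain ⟨s, a, b, h⟩ := hd
  have hrow : ∀ k : ℕ, k₁ < k → (r * k : ℤ) ≤ s.deg 0 + (a * k + b) ∧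
      s.deg 0 + (a * k + b) ≤ r * k + N := by
    intro k hk
    have h1 := (pureDiagram_mem_bettiWindow_iff.1 (hw k hk)).2 0
    rw [h k] at h1
    simp only [Fin.val_zero, Nat.cast_zero, sub_zero] at h1
    exact h1
  obtain rfl : a = r := by
    have h1 := hrow (k₁ + 1) (by omega)
    have h2 := hrow (k₁ + 1 + (N + 1)) (by omega)
    push_cast at h1 h2
    by_contra hne
    rcases lt_or_gt_of_ne hne with hlt | hlt
    · nlinarith
    · nlinarith
  refine ⟨fun p j => pureDiagram s p (j - b), fun k p j => ?_⟩
  rw [h, pureDiagram_translate]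
  congr 1
  ring

end BoijSoederberg

open BoijSoederberg
theorem theorem3p2 {K : Type*} [Field K] (n r : ℕ) (I : Ideal (MvPolynomial (Fin n) K))
    (hI : IsEquigenerated I r) :
    (∃ N : ℕ, IsPowersWindow I r N) ∧
    ∀ N : ℕ, IsPowersWindow I r N →
      ∃ k₁ : ℕ, ∀ (l : ℕ) (d : Fin (l + 1) → ℕ → DegreeSequence),
        (∀ i, IsTranslatedFamily (d i)) →
        (∀ k : ℕ, k₁ < k → IsMaximalChain n (r * k) (r * k + N) (fun i => d i k)) →
        ∃ w : Fin (l + 1) → Polynomial ℚ, ∀ k : ℕ, k₁ < k → ∀ c : Fin (l + 1) → ℚ,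
          bettiDiagram (I ^ k) = ∑ i, c i • pureDiagram (d i k) ↔
            ∀ i, c i = (w i).eval (k : ℚ) := by
  obtain ⟨N₀, hN₀⟩ := hI.exists_bettiWindow
  refine ⟨⟨N₀, 0, fun k _ => hN₀ k⟩, fun N ⟨k₀, hk₀⟩ => ?_⟩
  choose f hf using fun q : Fin (n + 1) × Fin (N + 1) =>
    hI.eventuallyPolynomial_bettiDiagram q.1 q.2
  obtain ⟨k₁, hk₁⟩ := Filter.eventually_atTop.1 (Filter.eventually_all.2 hf)
  refine ⟨max k₀ k₁, fun l d hd hmax => ?_⟩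
  obtain ⟨A, hA⟩ := (hmax (max k₀ k₁ + 1) (Nat.lt_succ_self _)).exists_coefficients
  refine ⟨fun i => ∑ q, Polynomial.C (A i q) * f q, fun k hk c => ?_⟩
  have hvec : ∀ i, windowVector n (r * k) N (pureDiagram (d i k)) =
      windowVector n (r * (max k₀ k₁ + 1 : ℕ)) N (pureDiagram (d i (max k₀ k₁ + 1))) := by
    intro i
    obtain ⟨b, hb⟩ := (hd i).exists_pureDiagram_eq fun k hk => (hmax k hk).2.1 i
    funext q
    rw [windowVector_apply, windowVector_apply, add_assoc, add_assoc, hb, hb]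
  have hbetti : ∀ q, windowVector n (r * k) N (bettiDiagram (I ^ k)) q = (f q).eval (k : ℚ) :=
    hk₁ k ((le_max_right _ _).trans hk.le)
  have hwin : bettiDiagram (I ^ k) = ∑ i, c i • pureDiagram (d i k) ↔
      windowVector n (r * k) N (bettiDiagram (I ^ k)) =
        ∑ i, c i • windowVector n (r * k) N (pureDiagram (d i k)) := by
    have hsum : ∑ i, c i • windowVector n (r * k) N (pureDiagram (d i k)) =
        windowVector n (r * k) N (∑ i, c i • pureDiagram (d i k)) := by simp [map_sum]
    rw [hsum]
    refine ⟨fun h => by rw [h], eq_of_windowVector_eq (hk₀ k ((le_max_left _ _).trans_lt hk)) ?_⟩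
    exact Submodule.sum_mem _ fun i _ => Submodule.smul_mem _ _ ((hmax k hk).2.1 i)
  rw [hwin]
  simp only [hvec, hA, hbetti, Polynomial.eval_finsetSum, Polynomial.eval_mul, Polynomial.eval_C]
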